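/- **Setting.** Consider a dynamic discrete-choice game with finitely many players $j\in J$, actions $a\in\{0,\dots,m\}$ (write $\tilde A=\{1,\dots,m\}$), observed states $x\in X$ (finite), discount factors $\beta_j\in(0,1)$, period payoffs $\pi_j(\vec a,x)$, transition probabilities $f(x'\mid \vec a,x)$, and private action-specific shocks $\epsilon_j\in\mathbb R^{m+1}$ that are independent across players given $x$, have a density and full support, and satisfy that $E[\epsilon_j(a)\mid \epsilon_j(a)\ge c]$ is finite for all $c$. All primitives depend on $(\alpha,g)$, with $\alpha\in\Theta_\alpha\subseteq\mathbb R^{d_\alpha}$, $g\in\mathbb R^{d_g}$. For conditional choice probabilities (CCPs) $P=\{P_j(a|x):(j,a,x)\in J\times\tilde A\times X\}\in\mathbb R^{d_P}$, let $\Psi(\alpha,g,P)$ be the best-response probabilities $\Psi_j(a,x)=\Pr[u_j(a,x)+\epsilon_j(a)\ge u_j(k,x)+\epsilon_j(k)\ \forall k]$, where $u_j$ is the choice value computed with beliefs $P$ and with the ex-ante value function solving $V_j=(I-\beta_jF^P)^{-1}\big[\text{expected current payoff under }P\big]$. **Assumptions.** (1) The data $(\vec a_i,x_i,x_i')$, $i\le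 n$, are i.i.d. from one Markov perfect equilibrium of the game with parameters $(\alpha^*,g^*)$; $P^*$ denotes its CCPs and $m^*(x)=\Pr[x_i=x]$. (2) For $\alpha\in\Theta_\alpha$: $\Psi(\alpha,g^*,P^*)=P^*$ iff $\alpha=\alpha^*$. (3) $\Theta_\alpha$ is compact, $\Psi(\cdot,g^*,P^*)$ is continuous on $\Theta_\alpha$, and $\alpha^*$ is interior to $\Theta_\alpha$; $\sup_{\alpha\in\Theta_\alpha}|\Psi(\alpha,g,P)-\Psi(\alpha,g^*,P^*)|\to0$ as $(g,P)\to(g^*,P^*)$; for $(g,P)$ near $(g^*,P^*)$, $\inf_{\alpha\in\Theta_\alpha}\Psi_j(a,x;\alpha,g,P)>0$ for all $j,x$ and all actions $a$ (including $0$); $\Psi$ is $C^2$ near $(\alpha^*,g^*,P^*)$, with Jacobians $\Psi_\alpha,\Psi_g,\Psi_P$ there; $(I-\Psi_P,-\Psi_g)$ has rank $d_P$ and $\Psi_\alpha$ has rank $d_\alpha$. (4) With $\hat P$ the sample frequency estimator of $P^*$ and $(\hat P_0,\hat g)$ preliminary estimators of $(P^*,g^*)$, $\sqrt n(\hat P-P^*,\hat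 P_0-P^*,\hat g-g^*)\overset d\to N(0,\Omega)$, where $\Omega$ has blocks $\Omega_{PP},\Omega_{P0},\Omega_{Pg},\Omega_{00},\Omega_{0g},\Omega_{gg}$ and $\Omega_{PP}$ is block diagonal with blocks $(\mathrm{diag}\,P^*_{jx}-P^*_{jx}P^{*\prime}_{jx})/m^*(x)$, $P^*_{jx}=\{P^*_j(a|x):a\in\tilde A\}$. (5) The asymptotic variance of $(\hat P,\hat g)$ is nonsingular, and for every $d_P\times d_P$ matrix $M$, the asymptotic variance of $((I-M)\hat P+M\hat P_0,\hat g)$ minus that of $(\hat P,\hat g)$ is positive semidefinite (PSD). (6) The weights $\hat W_k$ are PSD, $\hat W_k\overset p\to W_k$, and $W_k$ is symmetric positive definite, $k\le K$. **Estimators.** Fix $K\ge1$. Starting from an initial CCP estimator, for $k=1,\dots,K$ let $\hat\alpha_k$ maximize $\hat Q_k(\alpha,\hat g,\hat P_{k-1})$ over $\alpha\in\Theta_\alpha$ (measurably, with probability approaching one) and set $\hat P_k=\Psi(\hat\alpha_k,\hat g,\hat P_{k-1})$. The $K$-MD estimator is $\hat\alpha_K$ for $\hat Q_k(\alpha,g,P)=-(\hat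 P-\Psi(\alpha,g,P))'\hat W_k(\hat P-\Psi(\alpha,g,P))$; the $K$-PML estimator is $\hat\alpha_K$ for the pseudo log-likelihood $\hat Q_k(\alpha,g,P)=n^{-1}\sum_{i\le n}\sum_j\ln\Psi_j(\alpha,g,P)(a_{j,i}|x_i)$. **Variances.** Let $L_k=(\Psi_\alpha'W_k\Psi_\alpha)^{-1}\Psi_\alpha'W_k$, $\Phi_{1,P}=0$, $\Phi_{1,0}=I$, $\Phi_{1,g}=0$ and $\Phi_{k+1,P}=(I-\Psi_\alpha L_k)\Psi_P\Phi_{k,P}+\Psi_\alpha L_k$, $\Phi_{k+1,0}=(I-\Psi_\alpha L_k)\Psi_P\Phi_{k,0}$, $\Phi_{k+1,g}=(I-\Psi_\alpha L_k)(I+\Psi_P\Phi_{k,g})$. Put $R_K=[\,I-\Psi_P\Phi_{K,P},\ -\Psi_P\Phi_{K,0},\ -(I+\Psi_P\Phi_{K,g})\Psi_g\,]$ and $\Sigma_{K\text{-}MD}(\hat P_0,\{W_k\})=L_KR_K\,\Omega\,R_K'L_K'$. Let $\Sigma_{K\text{-}PML}(\hat P_0)$ be the same expression with $W_k=\Omega_{PP}^{-1}$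 for all $k$. Let $$\Delta_K=\big[I-\Psi_P(\Phi_{K,P}+\Phi_{K,0}),\ -(I+\Psi_P\Phi_{K,g})\Psi_g\big]\begin{pmatrix}\Omega_{PP}&\Omega_{Pg}\\ \Omega_{Pg}'&\Omega_{gg}\end{pmatrix}\big[I-\Psi_P(\Phi_{K,P}+\Phi_{K,0}),\ -(I+\Psi_P\Phi_{K,g})\Psi_g\big]'$$ (it depends on $W_1,\dots,W_{K-1}$ only), $W_1^*=[(I-\Psi_P)\Omega_{PP}(I-\Psi_P')+\Psi_g\Omega_{gg}\Psi_g'-\Psi_g\Omega_{Pg}'(I-\Psi_P')-(I-\Psi_P)\Omega_{Pg}\Psi_g']^{-1}$ and $\Sigma^*=(\Psi_\alpha'W_1^*\Psi_\alpha)^{-1}$. Call $\tilde P$ asymptotically equivalent to $\hat P$ if $\sqrt n(\tilde P-P^*)=\sqrt n(\hat P-P^*)+o_p(1)$. Given $W_1,\dots,W_{K-1}$, call a positive definite $W_K$ optimal in step $K$ if $\Sigma_{K\text{-}MD}(\tilde P,\{W_1,\dots,W_{K-1},V\})-\Sigma_{K\text{-}MD}(\tilde P,\{W_1,\dots,W_K\})$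 is PSD for all positive definite $V$. **Theorem (invariance and optimality).** Under these assumptions, for every fixed $K\ge1$: 1. *Invariance.* Let $W_1,\dots,W_{K-1}$ be positive definite and suppose $\Delta_K$ is nonsingular. Then $\Delta_K^{-1}$ is an optimal weight in step $K$. If $\tilde P$ is asymptotically equivalent to $\hat P$, then $(\hat P,\tilde P,\hat g)$ is jointly asymptotically normal with the variance obtained from $\Omega$ by replacing $\Omega_{P0},\Omega_{00}$ by $\Omega_{PP}$ and $\Omega_{0g}$ by $\Omega_{Pg}$, and the $K$-MD estimator $\hat\alpha^*_{K\text{-}MD}$ with initial CCP estimator $\tilde P$, weights $W_1,\dots,W_{K-1}$ in the first $K-1$ steps and any optimal weight in step $K$ satisfies $\sqrt n(\hat\alpha^*_{K\text{-}MD}-\alpha^*)\overset d\to N(0,\Sigma^*)$. 2. *Optimality.* The $K$-MD estimator with initial CCP estimator $\hat P_0$ and weights $\{W_k:k\le K\}$ satisfies $\sqrt n(\hat\alpha_{K\text{-}MD}-\alpha^*)\overset d\to N(0,\Sigma_{K\text{-}MD}(\hat P_0,\{W_k\}))$, and $\Sigma_{K\text{-}MD}(\hat P_0,\{W_k\})-\Sigma^*$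 is PSD. 3. *The optimal $1$-MD estimator.* $W_1^*$ is well defined and positive definite, it is an optimal weight for $K=1$, $\Sigma^*$ is positive definite and equals $\Sigma_{1\text{-}MD}(\tilde P,W_1^*)$, and every $1$-MD estimator with initial CCP estimator asymptotically equivalent to $\hat P$ and limiting weight $W_1^*$ satisfies $\sqrt n(\hat\alpha^*_{1\text{-}MD}-\alpha^*)\overset d\to N(0,\Sigma^*)$. Hence it is efficient among all $K$-MD estimators. 4. *Comparison with PML.* The $K$-PML estimator with initial CCP estimator $\hat P_0$ satisfies $\sqrt n(\hat\alpha_{K\text{-}PML}-\alpha^*)\overset d\to N(0,\Sigma_{K\text{-}PML}(\hat P_0))$, and $\Sigma_{K\text{-}PML}(\hat P_0)-\Sigma^*$ is PSD. -/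

import Mathlib

open MeasureTheory ProbabilityTheory Filter Topology

noncomputable section

/-! ## The dynamic game -/

/-- Primitives of a dynamic discrete-choice game with players `J`, common observed states `X` and
actions `Fin (m + 1)`, where `0` is the outside option. `shock j x` is the law of the private
action-specific shock `ε_j` of player `j` given the observed state `x`; private shocks are
independent across players. `trans a x x'` is the probability of moving from `x` to `x'` under the
action profile `a`. -/
structure DynamicGame (J X : Type*) [Fintype J] [Fintype X] (m : ℕ) where
  payoff : J → (J → Fin (m + 1)) → X → ℝ
  discount : J → ℝ
  discount_mem : ∀ j, discount j ∈ Set.Ioo (0 : ℝ) 1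
  shock : J → X → Measure (Fin (m + 1) → ℝ)
  shock_prob : ∀ j x, IsProbabilityMeasure (shock j x)
  shock_density : ∀ j x, shock j x ≪ volume
  shock_fullSupport : ∀ j x, (shock j x).IsOpenPosMeasure
  shock_mean : ∀ j x a (c : ℝ), IntegrableOn (fun e => e a) {e | c ≤ e a} (shock j x)
  trans : (J → Fin (m + 1)) → X → X → ℝ
  trans_nonneg : ∀ a x x', 0 ≤ trans a x x'
  trans_sum : ∀ a x, ∑ x', trans a x x' = 1

/-- Index set of conditional choice probabilities (CCPs): players, actions other than the outside
option (`a : Fin m` stands for the action `a.succ`), states. -/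
abbrev CCPIndex (J X : Type*) (m : ℕ) : Type _ := J × Fin m × X

/-- Vectors of CCPs, i.e. `ℝ^{d_P}`. -/
abbrev CCP (J X : Type*) (m : ℕ) : Type _ := EuclideanSpace ℝ (CCPIndex J X m)

/-- `P_j(· | x)` on all actions, with `P_j(0 | x) = 1 - ∑ P_j(a | x)`. -/
def CCP.full {J X : Type*} {m : ℕ} (P : CCP J X m) (j : J) (x : X) : Fin (m + 1) → ℝ :=
  Fin.cons (1 - ∑ a : Fin m, P (j, a, x)) (fun a : Fin m => P (j, a, x))

/-- Shocks for which action `a` is optimal when the choice values (net of shocks) are `v`. -/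
def optRegion {m : ℕ} (v : Fin (m + 1) → ℝ) (a : Fin (m + 1)) : Set (Fin (m + 1) → ℝ) :=
  {e | ∀ k, v k + e k ≤ v a + e a}

open Classical in
/-- The choice values, normalised at the outside option, that rationalise the choice probabilities
`p` under the shock law `ν` (the Hotz-Miller inversion; `0` if there are none). -/
def invertCCP {m : ℕ} (ν : Measure (Fin (m + 1) → ℝ)) (p : Fin (m + 1) → ℝ) : Fin (m + 1) → ℝ :=
  if h : ∃ v : Fin (m + 1) → ℝ, v 0 = 0 ∧ ∀ a, ν.real (optRegion v a) = p a then h.choose else 0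

/-- Expected shock of the chosen action when choices are made optimally and with choice
probabilities `p`: `∑_a p(a) E[ε(a) | a optimal]`. -/
def expectedShock {m : ℕ} (ν : Measure (Fin (m + 1) → ℝ)) (p : Fin (m + 1) → ℝ) : ℝ :=
  ∑ a, ∫ e in optRegion (invertCCP ν p) a, e a ∂ν

namespace DynamicGame

variable {J X : Type*} [Fintype J] [DecidableEq J] [Fintype X] [DecidableEq X] {m : ℕ}
  (G : DynamicGame J X m)

/-- Value of action `a` for player `j` in state `x`, net of the current shock, when the other
players choose according to `P` and the continuation values are `V`. -/
def choiceValue (P : CCP J X m) (V : X → ℝ) (j : J) (x : X) (a : Fin (m + 1)) : ℝ :=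
  ∑ b : J → Fin (m + 1), if b j = a then
    (∏ s ∈ Finset.univ.erase j, P.full s x (b s)) *
      (G.payoff j b x + G.discount j * ∑ x', G.trans b x x' * V x') else 0

/-- Expected current payoff (shock of the chosen action included) of player `j` if everybody
behaves according to `P`. -/
def flowPayoff (P : CCP J X m) (j : J) (x : X) : ℝ :=
  (∑ b : J → Fin (m + 1), (∏ s, P.full s x (b s)) * G.payoff j b x)
    + expectedShock (G.shock j x) (P.full j x)

/-- State transition matrix induced by `P`. -/
def stateTransition (P : CCP J X m) : Matrix X X ℝ :=
  Matrix.of fun x x' => ∑ b : J → Fin (m + 1), (∏ s, P.full s x (b s)) * G.trans b x x'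

/-- Ex-ante value function `V_j(· ; P)`: the solution of the valuation equation
`V = flowPayoff + β_j • F^P V`. -/
def value (P : CCP J X m) (j : J) : X → ℝ :=
  Matrix.mulVec (1 - G.discount j • G.stateTransition P)⁻¹ (G.flowPayoff P j)

/-- The best-response probability mapping `P ↦ Ψ(P)`. -/
def psi (P : CCP J X m) : CCP J X m :=
  WithLp.toLp 2 fun i => (G.shock i.1 i.2.2).real
    (optRegion (G.choiceValue P (G.value P i.1) i.1 i.2.2) i.2.1.succ)

/-- `(σ, P)` is a Markov perfect equilibrium in pure strategies: `σ j x e` is the action of player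
`j` in state `x` with private shock `e`; beliefs `P` are the choice probabilities of `σ`; and, `V j`
being player `j`'s ex-ante value of the strategy profile, `σ` is optimal after every `(x, e)`. -/
structure IsMPE (σ : J → X → (Fin (m + 1) → ℝ) → Fin (m + 1)) (P : CCP J X m) : Prop where
  measurable : ∀ j x, Measurable (σ j x)
  rational : ∀ j a x, P (j, a, x) = (G.shock j x).real {e | σ j x e = a.succ}
  optimal : ∃ V : J → X → ℝ,
    (∀ j x, Integrable (fun e => e (σ j x e)) (G.shock j x) ∧
      V j x = ∫ e, (G.choiceValue P (V j) j x (σ j x e) + e (σ j x e)) ∂(G.shock j x)) ∧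
    ∀ j x e k, G.choiceValue P (V j) j x k + e k
      ≤ G.choiceValue P (V j) j x (σ j x e) + e (σ j x e)

end DynamicGame

/-! ## Matrix expressions

Below `A`, `D`, `C` stand for the Jacobians `Ψ_α`, `Ψ_P`, `Ψ_g`, and `W k` for the weight matrix of
step `k`, where steps are counted from `1`. -/

section Matrices

variable {ι κ γ : Type*} [Fintype ι] [DecidableEq ι] [Fintype κ] [DecidableEq κ]
  [Fintype γ] [DecidableEq γ]

/-- Jacobian matrix. -/
def jacobian (f : EuclideanSpace ℝ κ → EuclideanSpace ℝ ι) (x : EuclideanSpace ℝ κ) :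
    Matrix ι κ ℝ :=
  Matrix.of fun i k => fderiv ℝ f x (EuclideanSpace.single k 1) i

/-- `(Ψ_α' W Ψ_α)⁻¹ Ψ_α' W`. -/
def wlsMap (A : Matrix ι κ ℝ) (W : Matrix ι ι ℝ) : Matrix κ ι ℝ :=
  (A.transpose * W * A)⁻¹ * A.transpose * W

/-- `Φ_{k,P}` (the value at `k = 0` is not used). -/
def phiP (A : Matrix ι κ ℝ) (D : Matrix ι ι ℝ) (W : ℕ → Matrix ι ι ℝ) : ℕ → Matrix ι ι ℝ
  | 0 => 0
  | 1 => 0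
  | k + 2 => (1 - A * wlsMap A (W (k + 1))) * D * phiP A D W (k + 1) + A * wlsMap A (W (k + 1))

/-- `Φ_{k,0}` (the value at `k = 0` is not used). -/
def phi0 (A : Matrix ι κ ℝ) (D : Matrix ι ι ℝ) (W : ℕ → Matrix ι ι ℝ) : ℕ → Matrix ι ι ℝ
  | 0 => 1
  | 1 => 1
  | k + 2 => (1 - A * wlsMap A (W (k + 1))) * D * phi0 A D W (k + 1)

/-- `Φ_{k,g}` (the value at `k = 0` is not used). -/
def phiG (A : Matrix ι κ ℝ) (D : Matrix ι ι ℝ) (W : ℕ → Matrix ι ι ℝ) : ℕ → Matrix ι ι ℝ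
  | 0 => 0
  | 1 => 0
  | k + 2 => (1 - A * wlsMap A (W (k + 1))) * (1 + D * phiG A D W (k + 1))

/-- The asymptotic variance matrix of `(P̂, P̂₀, ĝ)`, assembled from its blocks. -/
def blockVar (OPP OP0 O00 : Matrix ι ι ℝ) (OPg O0g : Matrix ι γ ℝ) (Ogg : Matrix γ γ ℝ) :
    Matrix (ι ⊕ (ι ⊕ γ)) (ι ⊕ (ι ⊕ γ)) ℝ :=
  Matrix.fromBlocks OPP (Matrix.fromCols OP0 OPg)
    (Matrix.fromRows OP0.transpose OPg.transpose)
    (Matrix.fromBlocks O00 O0g O0g.transpose Ogg)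

/-- `Σ_{K-MD}` as a function of the Jacobians, the asymptotic variance `O` of `(P̂, P̂₀, ĝ)` and the
limiting weights `W 1, …, W K`. -/
def sigmaMDFormula (A : Matrix ι κ ℝ) (D : Matrix ι ι ℝ) (C : Matrix ι γ ℝ)
    (O : Matrix (ι ⊕ (ι ⊕ γ)) (ι ⊕ (ι ⊕ γ)) ℝ) (W : ℕ → Matrix ι ι ℝ) (K : ℕ) :
    Matrix κ κ ℝ :=
  let R : Matrix ι (ι ⊕ (ι ⊕ γ)) ℝ :=
    Matrix.fromCols (1 - D * phiP A D W K)
      (Matrix.fromCols (-(D * phi0 A D W K)) (-((1 + D * phiG A D W K) * C)))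
  wlsMap A (W K) * R * O * R.transpose * (wlsMap A (W K)).transpose

/-- The matrix `Δ_K`: asymptotic variance of the (non-projected) moment of step `K` when the initial
CCP estimator is asymptotically equivalent to the sample frequencies. It depends on the weights
`W 1, …, W (K - 1)` only. -/
def deltaFormula (A : Matrix ι κ ℝ) (D : Matrix ι ι ℝ) (C : Matrix ι γ ℝ)
    (OPP : Matrix ι ι ℝ) (OPg : Matrix ι γ ℝ) (Ogg : Matrix γ γ ℝ)
    (W : ℕ → Matrix ι ι ℝ) (K : ℕ) : Matrix ι ι ℝ :=
  let R : Matrix ι (ι ⊕ γ) ℝ :=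
    Matrix.fromCols (1 - D * (phiP A D W K + phi0 A D W K)) (-((1 + D * phiG A D W K) * C))
  R * Matrix.fromBlocks OPP OPg OPg.transpose Ogg * R.transpose

/-- The inverse of the optimal weight matrix for `K = 1`. -/
def optWeightInv (D : Matrix ι ι ℝ) (C : Matrix ι γ ℝ)
    (OPP : Matrix ι ι ℝ) (OPg : Matrix ι γ ℝ) (Ogg : Matrix γ γ ℝ) : Matrix ι ι ℝ :=
  (1 - D) * OPP * (1 - D.transpose) + C * Ogg * C.transpose
    - C * OPg.transpose * (1 - D.transpose) - (1 - D) * OPg * C.transpose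

end Matrices

/-! ## Data, estimators and assumptions -/

/-- One observation `(a⃗, x, x')`: action profile, current state, next state. -/
abbrev Obs (J X : Type*) (m : ℕ) : Type _ := (J → Fin (m + 1)) × X × X

/-- `√n (α̂_n - α*)` converges in distribution to `N(0, S)`. -/
def AsympNormal {Ω ι : Type*} [MeasurableSpace Ω] [Fintype ι] [DecidableEq ι] (μ : Measure Ω)
    [IsProbabilityMeasure μ] (est : ℕ → Ω → EuclideanSpace ℝ ι) (center : EuclideanSpace ℝ ι)
    (S : Matrix ι ι ℝ) : Prop :=
  S.PosSemidef ∧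
    TendstoInDistribution (fun (n : ℕ) ω => √(n : ℝ) • (est n ω - center)) atTop
      (id : EuclideanSpace ℝ ι → EuclideanSpace ℝ ι) (fun _ => μ) (multivariateGaussian 0 S)

/-- Weight matrices of the steps `1, …, K`: `Ŵ_k` is positive semidefinite and converges in
probability to `W_k`, which is symmetric positive definite. -/
def WeightMatrices {Ω ι : Type*} [MeasurableSpace Ω] [Fintype ι] (μ : Measure Ω) (K : ℕ)
    (What : ℕ → ℕ → Ω → Matrix ι ι ℝ) (W : ℕ → Matrix ι ι ℝ) : Prop :=
  ∀ k ∈ Finset.Icc 1 K, (∀ n ω, (What k n ω).PosSemidef) ∧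
    (∀ i i', TendstoInMeasure μ (fun n ω => What k n ω i i') atTop (fun _ => W k i i')) ∧
    (W k).PosDef

/-- The objects of the estimation problem (no assumptions): a family of games indexed by
`(α, g)`, the space `Θ_α`, the true parameters, the observations, and the preliminary estimators
`P̂₀` and `ĝ` (indexed by the sample size), with candidate blocks of the joint asymptotic variance of
`(P̂, P̂₀, ĝ)`. -/
structure Environment (J X : Type*) [Fintype J] [Fintype X] (m dα dg : ℕ) (Ω : Type*) where
  game : EuclideanSpace ℝ (Fin dα) → EuclideanSpace ℝ (Fin dg) → DynamicGame J X m
  Θα : Set (EuclideanSpace ℝ (Fin dα))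
  αstar : EuclideanSpace ℝ (Fin dα)
  gstar : EuclideanSpace ℝ (Fin dg)
  data : ℕ → Ω → Obs J X m
  P0hat : ℕ → Ω → CCP J X m
  ghat : ℕ → Ω → EuclideanSpace ℝ (Fin dg)
  OP0 : Matrix (CCPIndex J X m) (CCPIndex J X m) ℝ
  O00 : Matrix (CCPIndex J X m) (CCPIndex J X m) ℝ
  OPg : Matrix (CCPIndex J X m) (Fin dg) ℝ
  O0g : Matrix (CCPIndex J X m) (Fin dg) ℝ
  Ogg : Matrix (Fin dg) (Fin dg) ℝ

namespace Environment

variable {J X : Type*} [Fintype J] [DecidableEq J] [Fintype X] [DecidableEq X]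
  [MeasurableSpace X] {m dα dg : ℕ} {Ω : Type*} [MeasurableSpace Ω]
  (E : Environment J X m dα dg Ω) (μ : Measure Ω)

/-- The mapping `Ψ(α, g, P)`. -/
def Psi (α : EuclideanSpace ℝ (Fin dα)) (g : EuclideanSpace ℝ (Fin dg)) (P : CCP J X m) :
    CCP J X m :=
  (E.game α g).psi P

/-- The DGP `Π*(a⃗, x, x')`. -/
def dgp (b : J → Fin (m + 1)) (x x' : X) : ℝ := μ.real {ω | E.data 0 ω = (b, x, x')}

/-- The marginal probability `m*(x)` of the current state. -/
def mstar (x : X) : ℝ := ∑ b : J → Fin (m + 1), ∑ x', E.dgp μ b x x'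

/-- The CCPs `P*` determined by the DGP. -/
def Pstar : CCP J X m :=
  WithLp.toLp 2 fun i =>
    (∑ b : J → Fin (m + 1), ∑ x', if b i.1 = i.2.1.succ then E.dgp μ b i.2.2 x' else 0)
      / E.mstar μ i.2.2

/-- The sample frequency estimator `P̂` based on the first `n` observations. -/
def Phat (n : ℕ) (ω : Ω) : CCP J X m :=
  WithLp.toLp 2 fun i =>
    ((∑ t ∈ Finset.range n,
        if (E.data t ω).1 i.1 = i.2.1.succ ∧ (E.data t ω).2.1 = i.2.2 then (1 : ℝ) else 0) / n)
      / ((∑ t ∈ Finset.range n, if (E.data t ω).2.1 = i.2.2 then (1 : ℝ) else 0) / n)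

/-- `Ω_PP = diag {Σ_{jx}}`, `Σ_{jx} = (diag P*_{jx} - P*_{jx} P*_{jx}') / m*(x)`. -/
def OPP : Matrix (CCPIndex J X m) (CCPIndex J X m) ℝ :=
  Matrix.of fun i i' =>
    if i.1 = i'.1 ∧ i.2.2 = i'.2.2 then
      ((if i.2.1 = i'.2.1 then E.Pstar μ i else 0) - E.Pstar μ i * E.Pstar μ i')
        / E.mstar μ i.2.2
    else 0

/-- `Ψ_α`. -/
def PsiA : Matrix (CCPIndex J X m) (Fin dα) ℝ :=
  jacobian (fun α => E.Psi α E.gstar (E.Pstar μ)) E.αstar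

/-- `Ψ_P`. -/
def PsiP : Matrix (CCPIndex J X m) (CCPIndex J X m) ℝ :=
  jacobian (fun P => E.Psi E.αstar E.gstar P) (E.Pstar μ)

/-- `Ψ_g`. -/
def PsiG : Matrix (CCPIndex J X m) (Fin dg) ℝ :=
  jacobian (fun g => E.Psi E.αstar g (E.Pstar μ)) E.gstar

/-- I.i.d. data from one Markov perfect equilibrium of the true game: given the current state,
actions follow the equilibrium CCPs and the next state follows the transition law. -/
structure IIDFromMPE : Prop where
  measurable : ∀ t, Measurable (E.data t)
  indep : iIndepFun E.data μ
  ident : ∀ t, IdentDistrib (E.data t) (E.data 0) μ μ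
  equilibrium : ∃ σ, (E.game E.αstar E.gstar).IsMPE σ (E.Pstar μ)
  law : ∀ b x x', E.dgp μ b x x' = E.mstar μ x * (∏ j, (E.Pstar μ).full j x (b j))
    * (E.game E.αstar E.gstar).trans b x x'

/-- Identification. -/
def Identification : Prop :=
  ∀ α ∈ E.Θα, E.Psi α E.gstar (E.Pstar μ) = E.Pstar μ ↔ α = E.αstar

/-- Regularity conditions. A uniform `o_p(1)` statement for all sequences
`(g̃, P̃) = (g*, P*) + o_p(1)` is uniform convergence as `(g, P) → (g*, P*)`. -/
structure Regularity : Prop where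
  compact : IsCompact E.Θα
  continuousOn : ContinuousOn (fun α => E.Psi α E.gstar (E.Pstar μ)) E.Θα
  interior : E.αstar ∈ interior E.Θα
  uniform : TendstoUniformlyOn
    (fun (z : EuclideanSpace ℝ (Fin dg) × CCP J X m) α => E.Psi α z.1 z.2)
    (fun α => E.Psi α E.gstar (E.Pstar μ)) (𝓝 (E.gstar, E.Pstar μ)) E.Θα
  positive : ∀ j x a, ∀ᶠ z in 𝓝 (E.gstar, E.Pstar μ),
    ∃ c > (0 : ℝ), ∀ α ∈ E.Θα, c ≤ (E.Psi α z.1 z.2).full j x a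
  smooth : ContDiffAt ℝ 2
    (fun z : EuclideanSpace ℝ (Fin dα) × EuclideanSpace ℝ (Fin dg) × CCP J X m =>
      E.Psi z.1 z.2.1 z.2.2) (E.αstar, E.gstar, E.Pstar μ)
  rank_fixedPoint :
    (Matrix.fromCols (1 - E.PsiP μ) (-E.PsiG μ)).rank = Fintype.card (CCPIndex J X m)
  rank_α : (E.PsiA μ).rank = dα

/-- `√n ((P̂, P̃, ĝ) - (P*, P*, g*))` converges in distribution to `N(0, O)`. -/
def JointNormal [IsProbabilityMeasure μ] (Ptilde : ℕ → Ω → CCP J X m)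
    (O : Matrix (CCPIndex J X m ⊕ (CCPIndex J X m ⊕ Fin dg))
      (CCPIndex J X m ⊕ (CCPIndex J X m ⊕ Fin dg)) ℝ) : Prop :=
  AsympNormal μ
    (fun n ω => WithLp.toLp 2 (Sum.elim (E.Phat n ω) (Sum.elim (Ptilde n ω) (E.ghat n ω))))
    (WithLp.toLp 2 (Sum.elim (E.Pstar μ) (Sum.elim (E.Pstar μ) E.gstar))) O

/-- The asymptotic variance of `(P̂, P̂₀, ĝ)`. -/
def O3 : Matrix (CCPIndex J X m ⊕ (CCPIndex J X m ⊕ Fin dg))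
    (CCPIndex J X m ⊕ (CCPIndex J X m ⊕ Fin dg)) ℝ :=
  blockVar (E.OPP μ) E.OP0 E.O00 E.OPg E.O0g E.Ogg

/-- The asymptotic variance of `(P̂, P̃, ĝ)` for `P̃` asymptotically equivalent to `P̂`. -/
def O3equiv : Matrix (CCPIndex J X m ⊕ (CCPIndex J X m ⊕ Fin dg))
    (CCPIndex J X m ⊕ (CCPIndex J X m ⊕ Fin dg)) ℝ :=
  blockVar (E.OPP μ) (E.OPP μ) (E.OPP μ) E.OPg E.OPg E.Ogg

/-- The asymptotic variance of `(P̂, ĝ)`. -/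
def O2 : Matrix (CCPIndex J X m ⊕ Fin dg) (CCPIndex J X m ⊕ Fin dg) ℝ :=
  Matrix.fromBlocks (E.OPP μ) E.OPg E.OPg.transpose E.Ogg

/-- Baseline convergence of `(P̂, P̂₀, ĝ)`. -/
def Baseline [IsProbabilityMeasure μ] : Prop := E.JointNormal μ E.P0hat (E.O3 μ)

/-- The matrix of the linear map `(u, v, w) ↦ ((I - M) u + M v, w)`. -/
def mixMatrix (M : Matrix (CCPIndex J X m) (CCPIndex J X m) ℝ) :
    Matrix (CCPIndex J X m ⊕ Fin dg) (CCPIndex J X m ⊕ (CCPIndex J X m ⊕ Fin dg)) ℝ :=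
  Matrix.fromBlocks (1 - M) (Matrix.fromCols M 0) 0 (Matrix.fromCols 0 1)

/-- The asymptotic variance of `(P̂, ĝ)` is nonsingular, and `(P̂, ĝ)` is at least as asymptotically
efficient as `((I - M) P̂ + M P̂₀, ĝ)` for every `M`. -/
structure BaselineII : Prop where
  nonsingular : IsUnit (E.O2 μ).det
  efficient : ∀ M : Matrix (CCPIndex J X m) (CCPIndex J X m) ℝ,
    (mixMatrix (dg := dg) M * E.O3 μ * (mixMatrix (dg := dg) M).transpose - E.O2 μ).PosSemidef

/-- `P̃` is asymptotically equivalent to the sample frequencies: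
`√n (P̃ - P*) = √n (P̂ - P*) + o_p(1)`. -/
def AsympEquiv (Ptilde : ℕ → Ω → CCP J X m) : Prop :=
  TendstoInMeasure μ
    (fun (n : ℕ) ω =>
      √(n : ℝ) • (Ptilde n ω - E.Pstar μ) - √(n : ℝ) • (E.Phat n ω - E.Pstar μ))
    atTop (fun _ => 0)

/-- The policy iteration `P̂_k = Ψ(α̂_k, ĝ, P̂_{k-1})` started at `Pinit`; `αhat k n` is the step-`k`
estimator at sample size `n`. -/
def iterCCP (Pinit : ℕ → Ω → CCP J X m) (αhat : ℕ → ℕ → Ω → EuclideanSpace ℝ (Fin dα)) :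
    ℕ → ℕ → Ω → CCP J X m
  | 0, n, ω => Pinit n ω
  | k + 1, n, ω => E.Psi (αhat (k + 1) n ω) (E.ghat n ω) (iterCCP Pinit αhat k n ω)

/-- The MD sample criterion (to be maximised). -/
def QMD (What : ℕ → ℕ → Ω → Matrix (CCPIndex J X m) (CCPIndex J X m) ℝ) (k n : ℕ) (ω : Ω)
    (α : EuclideanSpace ℝ (Fin dα)) (g : EuclideanSpace ℝ (Fin dg)) (P : CCP J X m) : ℝ :=
  -(dotProduct (fun i => E.Phat n ω i - E.Psi α g P i)
    (Matrix.mulVec (What k n ω) (fun i => E.Phat n ω i - E.Psi α g P i)))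

/-- The pseudo log-likelihood `n⁻¹ ∑_i ∑_j ln Ψ_j(α, g, P)(a_{j,i} | x_i)`. -/
def QPML (n : ℕ) (ω : Ω)
    (α : EuclideanSpace ℝ (Fin dα)) (g : EuclideanSpace ℝ (Fin dg)) (P : CCP J X m) : ℝ :=
  (∑ t ∈ Finset.range n, ∑ j,
    Real.log ((E.Psi α g P).full j (E.data t ω).2.1 ((E.data t ω).1 j))) / n

/-- `αhat 1, …, αhat K` are the estimators of a `K`-stage policy iteration procedure with initial
CCP estimator `Pinit` and step-`k` criterion `Q k n ω`: measurable, and with probability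
approaching one as `n → ∞` (in particular: if always) `α̂_k` maximises
`Q k n ω (·, ĝ, P̂_{k-1})` over `Θ_α`. -/
def IsPIEstimator (K : ℕ) (Pinit : ℕ → Ω → CCP J X m)
    (Q : ℕ → ℕ → Ω → EuclideanSpace ℝ (Fin dα) → EuclideanSpace ℝ (Fin dg) → CCP J X m → ℝ)
    (αhat : ℕ → ℕ → Ω → EuclideanSpace ℝ (Fin dα)) : Prop :=
  ∀ k ∈ Finset.Icc 1 K, (∀ n, AEMeasurable (αhat k n) μ) ∧
    Tendsto (fun n => μ {ω | ¬ (αhat k n ω ∈ E.Θα ∧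
      IsMaxOn (fun α => Q k n ω α (E.ghat n ω) (E.iterCCP Pinit αhat (k - 1) n ω))
        E.Θα (αhat k n ω))}) atTop (𝓝 0)

/-- The `K`-MD estimator. -/
def IsKMD (K : ℕ) (Pinit : ℕ → Ω → CCP J X m)
    (What : ℕ → ℕ → Ω → Matrix (CCPIndex J X m) (CCPIndex J X m) ℝ)
    (αhat : ℕ → ℕ → Ω → EuclideanSpace ℝ (Fin dα)) : Prop :=
  E.IsPIEstimator μ K Pinit (E.QMD What) αhat

/-- The `K`-PML estimator. -/
def IsKPML (K : ℕ) (Pinit : ℕ → Ω → CCP J X m)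
    (αhat : ℕ → ℕ → Ω → EuclideanSpace ℝ (Fin dα)) : Prop :=
  E.IsPIEstimator μ K Pinit (fun _ => E.QPML) αhat

/-- `Σ_{K-MD}` for an initial CCP estimator such that `(P̂, P̂₀, ĝ)` has asymptotic variance `O`. -/
def sigmaMD (O : Matrix (CCPIndex J X m ⊕ (CCPIndex J X m ⊕ Fin dg))
      (CCPIndex J X m ⊕ (CCPIndex J X m ⊕ Fin dg)) ℝ)
    (W : ℕ → Matrix (CCPIndex J X m) (CCPIndex J X m) ℝ) (K : ℕ) : Matrix (Fin dα) (Fin dα) ℝ :=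
  sigmaMDFormula (E.PsiA μ) (E.PsiP μ) (E.PsiG μ) O W K

/-- `Σ_{K-PML}`: the same expression with all weights equal to `Ω_PP⁻¹`. -/
def sigmaPML (K : ℕ) : Matrix (Fin dα) (Fin dα) ℝ :=
  E.sigmaMD μ (E.O3 μ) (fun _ => (E.OPP μ)⁻¹) K

/-- `Δ_K`. -/
def Delta (W : ℕ → Matrix (CCPIndex J X m) (CCPIndex J X m) ℝ) (K : ℕ) :
    Matrix (CCPIndex J X m) (CCPIndex J X m) ℝ :=
  deltaFormula (E.PsiA μ) (E.PsiP μ) (E.PsiG μ) (E.OPP μ) E.OPg E.Ogg W K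

/-- `W K` is an optimal weight matrix for step `K` given `W 1, …, W (K - 1)` and an initial CCP
estimator asymptotically equivalent to the sample frequencies: it minimises the asymptotic variance
over all symmetric positive definite matrices. -/
def IsOptimalLast (W : ℕ → Matrix (CCPIndex J X m) (CCPIndex J X m) ℝ) (K : ℕ) : Prop :=
  (W K).PosDef ∧ ∀ V : Matrix (CCPIndex J X m) (CCPIndex J X m) ℝ, V.PosDef →
    (E.sigmaMD μ (E.O3equiv μ) (Function.update W K V) K
      - E.sigmaMD μ (E.O3equiv μ) W K).PosSemidef

/-- The optimal weight matrix `W₁*` of the `1`-MD estimator. -/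
def W1star : Matrix (CCPIndex J X m) (CCPIndex J X m) ℝ :=
  (optWeightInv (E.PsiP μ) (E.PsiG μ) (E.OPP μ) E.OPg E.Ogg)⁻¹

/-- `Σ*`, the asymptotic variance of the optimal `1`-MD estimator. -/
def sigmaStar : Matrix (Fin dα) (Fin dα) ℝ :=
  ((E.PsiA μ).transpose
    * (optWeightInv (E.PsiP μ) (E.PsiG μ) (E.OPP μ) E.OPg E.Ogg)⁻¹ * E.PsiA μ)⁻¹

end Environment

end

/-!
The argument has a probabilistic half, which turns each estimator into a linear map of the
preliminary errors, and an algebraic half, which compares the resulting variances.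

*Expansion.* Convergence in probability is convergence along the filter `inProb μ` on `ℕ × Ω`, so
one step of the iteration can be analysed deterministically, along an arbitrary filter. Suppose that
the criterion of a step converges to one that only `P*` maximises and that its gradient at model
probabilities `p` near `P*` is `M (P̂ - p)` with weights `M → W_k` (`RegularCriterion`). Then the
maximiser is consistent by compactness of `Θ_α` and identification, and the first-order condition
`Ψ_α' M (P̂ - Ψ) = 0` gives, with `L_k = (Ψ_α' W_k Ψ_α)⁻¹ Ψ_α' W_k` and up to an error negligible
compared with that of `(P̂, P̂₀, ĝ)`,
`α̂_k - α* = L_k ((P̂ - P*) - Ψ_P (P̂_{k-1} - P*) - Ψ_g (ĝ - g*))` (`stage_expansion`). Substituting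
this into `P̂_k = Ψ(α̂_k, ĝ, P̂_{k-1})` produces the recursion of the matrices `Φ_k`, and the delta
method gives asymptotic normality with variance `L_K R_K Ω R_K' L_K'`
(`Environment.asympNormal_estimator`). Both criteria are regular. For minimum distance this is
immediate. The pseudo log-likelihood depends on the data only through the sample frequencies of the
states and `P̂`; its limit is maximised at `P*` by Gibbs' inequality, and its score has weights that
converge to `Ω_PP⁻¹` (`scoreWeight_mul_frequencyVar`).

*Invariance.* If the initial estimator is asymptotically equivalent to `P̂`, its error and that of
`P̂` act together through `I - Ψ_P (Φ_P + Φ_0) = B_K (I - Ψ_P)`, where `B_K = I + Ψ_P Φ_g`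
(`errorFactor`). Hence `Δ_K = B_K (W₁*)⁻¹ B_K'`, while `B_K Ψ_α = Ψ_α` because `L_k Ψ_α = I`. By the
Gauss–Markov theorem the best weight in step `K` is `Δ_K⁻¹`, with variance
`(Ψ_α' Δ_K⁻¹ Ψ_α)⁻¹ = (Ψ_α' W₁* Ψ_α)⁻¹ = Σ*`, whatever `K` and the earlier weights
(`optimal_variance_eq`).

*Optimality.* If no mixture of `P̂` and `P̂₀` improves on `P̂` jointly with `ĝ`, then `P̂₀ - P̂` is
asymptotically uncorrelated with `(P̂, ĝ)` (`uncorrelated_of_efficient`). So its contribution only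
adds a positive semidefinite term to the variance `L_K Δ_K L_K'` that obtains with `P̂` as the initial
estimator, and the latter is at least `Σ*` by Gauss–Markov, as `L_K B_K Ψ_α = I`.
-/

set_option linter.unusedSectionVars false

noncomputable section

/-! ### Convergence in probability as convergence along a filter -/

/-- The filter of events on `ℕ × Ω` whose sections have probability tending to one: `S` belongs to it
iff the (outer) measure of `{ω | (n, ω) ∉ S}` tends to zero. Convergence in probability to a constant
is convergence along this filter, and "with probability approaching one" is `Filter.Eventually`. -/
def inProb {Ω : Type*} [MeasurableSpace Ω] (μ : Measure Ω) : Filter (ℕ × Ω) where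
  sets := {S | Tendsto (fun n => μ {ω | (n, ω) ∉ S}) atTop (𝓝 0)}
  univ_sets := by simp
  sets_of_superset := by
    intro S T hS hST
    refine tendsto_of_tendsto_of_tendsto_of_le_of_le tendsto_const_nhds hS (fun _ => zero_le) ?_
    exact fun n => measure_mono fun ω hω h => hω (hST h)
  inter_sets := by
    intro S T hS hT
    have h := hS.add hT
    rw [add_zero] at h
    refine tendsto_of_tendsto_of_tendsto_of_le_of_le tendsto_const_nhds h (fun _ => zero_le) ?_
    refine fun n => (measure_mono ?_).trans (measure_union_le _ _)
    intro ω hω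
    by_cases h : (n, ω) ∈ S
    · exact Or.inr fun h' => hω ⟨h, h'⟩
    · exact Or.inl h

section InProb

variable {Ω : Type*} [MeasurableSpace Ω] {μ : Measure Ω}

lemma eventually_inProb {p : ℕ × Ω → Prop} :
    (∀ᶠ z in inProb μ, p z) ↔ Tendsto (fun n => μ {ω | ¬ p (n, ω)}) atTop (𝓝 0) := Iff.rfl

lemma tendsto_fst_inProb : Tendsto (fun z : ℕ × Ω => z.1) (inProb μ) atTop := by
  refine tendsto_atTop.2 fun N => eventually_inProb.2 ?_
  refine tendsto_const_nhds.congr' ?_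
  filter_upwards [eventually_ge_atTop N] with n hn
  simp [hn]

lemma tendstoInMeasure_const_iff {E : Type*} [PseudoMetricSpace E] {f : ℕ → Ω → E} {c : E} :
    TendstoInMeasure μ f atTop (fun _ => c) ↔
      Tendsto (fun z : ℕ × Ω => f z.1 z.2) (inProb μ) (𝓝 c) := by
  rw [tendstoInMeasure_iff_dist, Metric.tendsto_nhds]
  refine forall₂_congr fun ε hε => ?_
  rw [eventually_inProb]
  simp only [not_lt]

/-- A sequence converging in distribution is bounded in probability. -/
lemma tight_of_tendstoInDistribution {E Ω' : Type*} [NormedAddCommGroup E] [MeasurableSpace E]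
    [BorelSpace E] [IsProbabilityMeasure μ] [MeasurableSpace Ω'] {μ' : Measure Ω'}
    [IsProbabilityMeasure μ'] {X : ℕ → Ω → E} {Z : Ω' → E}
    (h : TendstoInDistribution X atTop Z (fun _ => μ) μ') {ε : ENNReal} (hε : 0 < ε) :
    ∃ M : ℝ, 0 < M ∧ ∀ᶠ n in atTop, μ {ω | M ≤ ‖X n ω‖} < ε := by
  set ν := μ'.map Z
  have : IsProbabilityMeasure ν := Measure.isProbabilityMeasure_map h.aemeasurable_limit
  let F : ℕ → Set E := fun k => {x | (k : ℝ) ≤ ‖x‖}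
  have hFc : ∀ k, IsClosed (F k) := fun k => isClosed_le continuous_const continuous_norm
  have hF : Tendsto (fun k => ν (F k)) atTop (𝓝 0) := by
    have h0 : ⋂ k, F k = ∅ := by
      ext x
      simp only [F, Set.mem_iInter, Set.mem_ofPred_eq, Set.mem_empty_iff_false, iff_false, not_forall,
        not_le]
      exact exists_nat_gt _
    rw [← measure_empty (μ := ν), ← h0]
    refine tendsto_measure_iInter_atTop (fun k => (hFc k).measurableSet.nullMeasurableSet) ?_
      ⟨0, measure_ne_top _ _⟩
    intro a b hab x hx
    simp only [F, Set.mem_ofPred_eq] at hx ⊢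
    exact le_trans (by exact_mod_cast hab) hx
  obtain ⟨k, hk, hk1⟩ := ((hF.eventually (gt_mem_nhds hε)).and (eventually_ge_atTop 1)).exists
  have := ProbabilityMeasure.limsup_measure_closed_le_of_tendsto h.tendsto (hFc k)
  have h2 := eventually_lt_of_limsup_lt (this.trans_lt hk)
  refine ⟨k, by exact_mod_cast hk1, ?_⟩
  filter_upwards [h2] with n hn
  refine lt_of_le_of_lt (Eq.le ?_) hn
  exact (Measure.map_apply_of_aemeasurable (h.forall_aemeasurable n) (hFc k).measurableSet).symm

/-- `o_p(1)` times `O_p(1)` is `o_p(1)`. -/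
lemma tendsto_zero_of_isLittleO {E E' Ω' : Type*} [NormedAddCommGroup E] [MeasurableSpace E]
    [BorelSpace E] [NormedAddCommGroup E'] [IsProbabilityMeasure μ] [MeasurableSpace Ω']
    {μ' : Measure Ω'} [IsProbabilityMeasure μ'] {X : ℕ → Ω → E} {Z : Ω' → E}
    (h : TendstoInDistribution X atTop Z (fun _ => μ) μ') {Y : ℕ × Ω → E'}
    (hY : Y =o[inProb μ] fun z => X z.1 z.2) : Tendsto Y (inProb μ) (𝓝 0) := by
  rw [Metric.tendsto_nhds]
  intro δ hδ
  rw [eventually_inProb, ENNReal.tendsto_nhds_zero]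
  intro ε hε
  have hε2 : 0 < ε / 2 := ENNReal.half_pos hε.ne'
  obtain ⟨M, hM, hMe⟩ := tight_of_tendstoInDistribution h hε2
  have h1 := hY.def (div_pos hδ hM)
  rw [eventually_inProb, ENNReal.tendsto_nhds_zero] at h1
  filter_upwards [h1 _ hε2, hMe] with n hn1 hn2
  calc _ ≤ μ ({ω | ¬ ‖Y (n, ω)‖ ≤ δ / M * ‖X n ω‖} ∪ {ω | M ≤ ‖X n ω‖}) := by
        refine measure_mono fun ω hω => ?_
        simp only [Set.mem_ofPred_eq, dist_zero_right, not_lt] at hω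
        by_contra hc
        simp only [Set.mem_union, Set.mem_ofPred_eq, not_or, not_le] at hc
        have : δ / M * ‖X n ω‖ < δ / M * M := by
          exact mul_lt_mul_of_pos_left hc.2 (div_pos hδ hM)
        rw [div_mul_cancel₀ _ hM.ne'] at this
        linarith [hc.1]
    _ ≤ ε / 2 + ε / 2 := (measure_union_le _ _).trans (add_le_add hn1 hn2.le)
    _ = ε := ENNReal.add_halves ε

/-- A root-`n` asymptotically normal estimator is consistent. -/
lemma AsympNormal.tendsto_inProb {ι : Type*} [Fintype ι] [DecidableEq ι] [IsProbabilityMeasure μ]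
    {X : ℕ → Ω → EuclideanSpace ℝ ι} {c : EuclideanSpace ℝ ι} {S : Matrix ι ι ℝ}
    (h : AsympNormal μ X c S) : Tendsto (fun z : ℕ × Ω => X z.1 z.2) (inProb μ) (𝓝 c) := by
  rw [tendsto_iff_norm_sub_tendsto_zero, ← tendsto_zero_iff_norm_tendsto_zero]
  refine tendsto_zero_of_isLittleO h.2 ?_
  have hs : Tendsto (fun z : ℕ × Ω => √(z.1 : ℝ)) (inProb μ) atTop :=
    Real.tendsto_sqrt_atTop.comp (tendsto_natCast_atTop_atTop.comp tendsto_fst_inProb)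
  refine Asymptotics.isLittleO_iff.2 fun ε hε => ?_
  filter_upwards [hs.eventually_ge_atTop (1 / ε)] with z hz
  rw [norm_smul, Real.norm_of_nonneg (Real.sqrt_nonneg _), ← mul_assoc]
  refine le_mul_of_one_le_left (norm_nonneg _) ?_
  rwa [div_le_iff₀' hε] at hz

end InProb

/-! ### Linear transformations of asymptotically normal estimators -/

lemma inner_toEuclideanLin {ι κ : Type*} [Fintype ι] [DecidableEq ι] [Fintype κ] [DecidableEq κ]
    (L : Matrix κ ι ℝ) (x : EuclideanSpace ℝ ι) (t : EuclideanSpace ℝ κ) :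
    inner ℝ (Matrix.toEuclideanLin L x) t
      = inner ℝ x (Matrix.toEuclideanLin L.transpose t) := by
  have := (Matrix.toEuclideanLin L).adjoint_inner_right x t
  rw [← Matrix.toEuclideanLin_conjTranspose_eq_adjoint, Matrix.conjTranspose_eq_transpose_of_trivial]
    at this
  exact this.symm

lemma map_multivariateGaussian {ι κ : Type*} [Fintype ι] [DecidableEq ι] [Fintype κ] [DecidableEq κ]
    {S : Matrix ι ι ℝ} (hS : S.PosSemidef) (L : Matrix κ ι ℝ) :
    (multivariateGaussian 0 S).map (Matrix.toEuclideanLin L).toContinuousLinearMap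
      = multivariateGaussian 0 (L * S * L.transpose) := by
  have hS' : (L * S * L.transpose).PosSemidef := by
    simpa using hS.mul_mul_conjTranspose_same L
  apply Measure.ext_of_charFun
  ext t
  have hadj : ∀ x : EuclideanSpace ℝ ι,
      inner ℝ ((Matrix.toEuclideanLin L).toContinuousLinearMap x) t
        = inner ℝ x (Matrix.toEuclideanLin L.transpose t) := fun x => inner_toEuclideanLin L x t
  rw [charFun_apply, integral_map (by fun_prop) (by fun_prop)]
  simp_rw [hadj]
  rw [← charFun_apply, charFun_multivariateGaussian hS, charFun_multivariateGaussian hS']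
  simp [Matrix.mul_assoc, Matrix.dotProduct_mulVec, Matrix.vecMul_mulVec, Matrix.toLpLin_apply]

/-- The delta method in matrix form. -/
lemma AsympNormal.of_linear {Ω ι κ : Type*} [MeasurableSpace Ω] {μ : Measure Ω}
    [IsProbabilityMeasure μ] [Fintype ι] [DecidableEq ι] [Fintype κ] [DecidableEq κ]
    {X : ℕ → Ω → EuclideanSpace ℝ ι} {c : EuclideanSpace ℝ ι} {S : Matrix ι ι ℝ}
    (h : AsympNormal μ X c S) (L : Matrix κ ι ℝ) {Y : ℕ → Ω → EuclideanSpace ℝ κ}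
    {d : EuclideanSpace ℝ κ} (hY : ∀ n : ℕ, AEMeasurable (fun ω => √(n : ℝ) • (Y n ω - d)) μ)
    (hYX : Tendsto (fun z : ℕ × Ω => √(z.1 : ℝ) • (Y z.1 z.2 - d)
      - Matrix.toEuclideanLin L (√(z.1 : ℝ) • (X z.1 z.2 - c))) (inProb μ) (𝓝 0)) :
    AsympNormal μ Y d (L * S * L.transpose) := by
  refine ⟨by simpa using h.1.mul_mul_conjTranspose_same L, ?_⟩
  have h1 := h.2.continuous_comp (Matrix.toEuclideanLin L).toContinuousLinearMap.continuous
  have h2 := tendstoInDistribution_of_tendstoInMeasure_sub (fun (n : ℕ) ω => √(n : ℝ) • (Y n ω - d)) _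
    h1 ?_ hY
  · refine ⟨hY, by fun_prop, ?_⟩
    have hν : (⟨(multivariateGaussian 0 (L * S * L.transpose)).map id,
          Measure.isProbabilityMeasure_map aemeasurable_id⟩ : ProbabilityMeasure _)
        = ⟨_, Measure.isProbabilityMeasure_map h2.aemeasurable_limit⟩ :=
      Subtype.ext (Measure.map_id.trans (map_multivariateGaussian h.1 L).symm)
    exact hν ▸ h2.tendsto
  · exact tendstoInMeasure_const_iff.2 hYX

lemma AsympNormal.of_isLittleO {Ω ι κ : Type*} [MeasurableSpace Ω] {μ : Measure Ω}
    [IsProbabilityMeasure μ] [Fintype ι] [DecidableEq ι] [Fintype κ] [DecidableEq κ]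
    {X : ℕ → Ω → EuclideanSpace ℝ ι} {c : EuclideanSpace ℝ ι} {S : Matrix ι ι ℝ}
    (h : AsympNormal μ X c S) (L : Matrix κ ι ℝ) {Y : ℕ → Ω → EuclideanSpace ℝ κ}
    {d : EuclideanSpace ℝ κ} (hY : ∀ n, AEMeasurable (Y n) μ)
    (hYX : (fun z : ℕ × Ω => Y z.1 z.2 - d - Matrix.toEuclideanLin L (X z.1 z.2 - c))
      =o[inProb μ] fun z => X z.1 z.2 - c) :
    AsympNormal μ Y d (L * S * L.transpose) := by
  refine h.of_linear L (fun n => (measurable_const_smul _).comp_aemeasurable ((hY n).sub_const d)) ?_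
  refine tendsto_zero_of_isLittleO h.2 ?_
  refine ((Asymptotics.isBigO_refl (fun z : ℕ × Ω => √(z.1 : ℝ)) (inProb μ)).smul_isLittleO
    hYX).congr_left fun z => ?_
  rw [smul_sub, map_smul]

/-! ### Matrix algebra of the iteration -/

section MatrixAlgebra

variable {ι κ γ : Type*} [Fintype ι] [DecidableEq ι] [Fintype κ] [DecidableEq κ]
  [Fintype γ] [DecidableEq γ] {A : Matrix ι κ ℝ} {D : Matrix ι ι ℝ} {C : Matrix ι γ ℝ}

lemma mulVec_injective_of_rank (hA : A.rank = Fintype.card κ) : Function.Injective A.mulVec := by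
  rw [Matrix.mulVec_injective_iff, linearIndependent_iff_card_eq_finrank_span, ← hA,
    Matrix.rank_eq_finrank_span_cols]
  rfl

lemma posDef_transpose_mul_mul (hA : A.rank = Fintype.card κ) {V : Matrix ι ι ℝ} (hV : V.PosDef) :
    (A.transpose * V * A).PosDef := by
  simpa using hV.conjTranspose_mul_mul_same (mulVec_injective_of_rank hA)

lemma wlsMap_mul (hA : A.rank = Fintype.card κ) {V : Matrix ι ι ℝ} (hV : V.PosDef) :
    wlsMap A V * A = 1 := by
  rw [wlsMap, Matrix.mul_assoc, Matrix.mul_assoc, ← Matrix.mul_assoc A.transpose]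
  exact Matrix.nonsing_inv_mul _
    ((Matrix.isUnit_iff_isUnit_det _).1 (posDef_transpose_mul_mul hA hV).isUnit)

/-- The matrix `B_k` through which, after `k - 1` iterations, both a common estimation error of the
initial CCPs and sample frequencies and the error of `ĝ` act on the moment of step `k`:
`I - Ψ_P (Φ_{k,P} + Φ_{k,0}) = B_k (I - Ψ_P)` and `I + Ψ_P Φ_{k,g} = B_k`. -/
def errorFactor (A : Matrix ι κ ℝ) (D : Matrix ι ι ℝ) (W : ℕ → Matrix ι ι ℝ) (k : ℕ) :
    Matrix ι ι ℝ :=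
  1 + D * phiG A D W k

lemma errorFactor_one (W : ℕ → Matrix ι ι ℝ) : errorFactor A D W 1 = 1 := by
  simp [errorFactor, phiG]

lemma errorFactor_add_two (W : ℕ → Matrix ι ι ℝ) (k : ℕ) : errorFactor A D W (k + 2)
    = 1 + D * ((1 - A * wlsMap A (W (k + 1))) * errorFactor A D W (k + 1)) := by
  simp [errorFactor, phiG]

lemma one_sub_mul_phi (W : ℕ → Matrix ι ι ℝ) (k : ℕ) :
    1 - D * (phiP A D W (k + 1) + phi0 A D W (k + 1)) = errorFactor A D W (k + 1) * (1 - D) := by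
  induction k with
  | zero => simp [phiP, phi0, errorFactor_one]
  | succ k ih =>
    have h : phiP A D W (k + 2) + phi0 A D W (k + 2) = 1 - (1 - A * wlsMap A (W (k + 1)))
        * (errorFactor A D W (k + 1) * (1 - D)) := by
      rw [← ih, phiP, phi0]
      noncomm_ring
    rw [h, errorFactor_add_two]
    noncomm_ring

/-- `B_K Ψ_α = Ψ_α`: this is why the choice of the first `K - 1` weights does not matter. -/
lemma errorFactor_mul (hA : A.rank = Fintype.card κ) {W : ℕ → Matrix ι ι ℝ} (k : ℕ)
    (hW : ∀ i ∈ Finset.Icc 1 k, (W i).PosDef) : errorFactor A D W (k + 1) * A = A := by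
  induction k with
  | zero => simp [errorFactor_one]
  | succ k ih =>
    have h1 := ih fun i hi => hW i (Finset.Icc_subset_Icc_right (by omega) hi)
    have h2 := wlsMap_mul hA (hW (k + 1) (by simp))
    rw [errorFactor_add_two, Matrix.add_mul, Matrix.mul_assoc, Matrix.mul_assoc, h1, Matrix.sub_mul,
      Matrix.mul_assoc, h2]
    simp

/-- `Φ_k` depends on the weights of the first `k - 1` steps only. -/
lemma phi_congr {W W' : ℕ → Matrix ι ι ℝ} (k : ℕ) (h : ∀ i < k, W i = W' i) :
    phiP A D W k = phiP A D W' k ∧ phi0 A D W k = phi0 A D W' k ∧ phiG A D W k = phiG A D W' k := by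
  induction k with
  | zero => simp [phiP, phi0, phiG]
  | succ k ih =>
    cases k with
    | zero => simp [phiP, phi0, phiG]
    | succ k =>
      obtain ⟨h1, h2, h3⟩ := ih fun i hi => h i (by omega)
      simp only [phiP, phi0, phiG]
      rw [h1, h2, h3, h (k + 1) (by omega)]
      simp

lemma optWeightInv_eq (OPP : Matrix ι ι ℝ) (OPg : Matrix ι γ ℝ) (Ogg : Matrix γ γ ℝ) :
    optWeightInv D C OPP OPg Ogg = Matrix.fromCols (1 - D) (-C)
      * Matrix.fromBlocks OPP OPg OPg.transpose Ogg * (Matrix.fromCols (1 - D) (-C)).transpose := by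
  rw [Matrix.transpose_fromCols, Matrix.fromCols_mul_fromBlocks, Matrix.fromCols_mul_fromRows,
    optWeightInv]
  simp only [Matrix.transpose_sub, Matrix.transpose_one, Matrix.transpose_neg, Matrix.add_mul,
    Matrix.neg_mul, Matrix.mul_neg]
  abel

lemma deltaFormula_eq (OPP : Matrix ι ι ℝ) (OPg : Matrix ι γ ℝ) (Ogg : Matrix γ γ ℝ)
    (W : ℕ → Matrix ι ι ℝ) (k : ℕ) :
    deltaFormula A D C OPP OPg Ogg W (k + 1) = errorFactor A D W (k + 1)
      * optWeightInv D C OPP OPg Ogg * (errorFactor A D W (k + 1)).transpose := by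
  have h : Matrix.fromCols (1 - D * (phiP A D W (k + 1) + phi0 A D W (k + 1)))
      (-((1 + D * phiG A D W (k + 1)) * C))
      = errorFactor A D W (k + 1) * Matrix.fromCols (1 - D) (-C) := by
    rw [one_sub_mul_phi, Matrix.mul_fromCols, Matrix.mul_neg]
    rfl
  rw [deltaFormula, h, optWeightInv_eq, Matrix.transpose_mul]
  simp only [Matrix.mul_assoc]

lemma fromCols_mul_blockVar (OPP O00 : Matrix ι ι ℝ) (OPg : Matrix ι γ ℝ) (Ogg : Matrix γ γ ℝ)
    (hP : OPP.transpose = OPP) {δ : Type*} (u v : Matrix δ ι ℝ) (w : Matrix δ γ ℝ) :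
    Matrix.fromCols u (Matrix.fromCols v w) * blockVar OPP OPP O00 OPg OPg Ogg
        * (Matrix.fromCols u (Matrix.fromCols v w)).transpose
      = Matrix.fromCols (u + v) w * Matrix.fromBlocks OPP OPg OPg.transpose Ogg
          * (Matrix.fromCols (u + v) w).transpose + v * (O00 - OPP) * v.transpose := by
  simp only [blockVar, Matrix.transpose_fromCols, Matrix.fromCols_mul_fromBlocks,
    Matrix.fromCols_mul_fromRows, Matrix.mul_fromCols, hP,
    Matrix.transpose_add, Matrix.add_mul, Matrix.mul_add, Matrix.mul_sub, Matrix.sub_mul]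
  abel

/-- If the error `P̂₀ - P̂` is uncorrelated with `(P̂, ĝ)`, it only adds a positive semidefinite term
to the asymptotic variance. -/
lemma sigmaMDFormula_uncorrelated (OPP O00 : Matrix ι ι ℝ) (OPg : Matrix ι γ ℝ) (Ogg : Matrix γ γ ℝ)
    (hP : OPP.transpose = OPP) (W : ℕ → Matrix ι ι ℝ) (k : ℕ) :
    sigmaMDFormula A D C (blockVar OPP OPP O00 OPg OPg Ogg) W k
      = wlsMap A (W k) * deltaFormula A D C OPP OPg Ogg W k * (wlsMap A (W k)).transpose
        + (wlsMap A (W k) * (D * phi0 A D W k)) * (O00 - OPP)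
          * (wlsMap A (W k) * (D * phi0 A D W k)).transpose := by
  have h := fromCols_mul_blockVar OPP O00 OPg Ogg hP (1 - D * phiP A D W k) (-(D * phi0 A D W k))
    (-((1 + D * phiG A D W k) * C))
  have h2 : 1 - D * phiP A D W k + -(D * phi0 A D W k)
      = 1 - D * (phiP A D W k + phi0 A D W k) := by noncomm_ring
  rw [h2] at h
  have h3 : ∀ (L : Matrix κ ι ℝ) (R : Matrix ι (ι ⊕ (ι ⊕ γ)) ℝ)
      (O : Matrix (ι ⊕ (ι ⊕ γ)) (ι ⊕ (ι ⊕ γ)) ℝ),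
      L * R * O * R.transpose * L.transpose = L * (R * O * R.transpose) * L.transpose := by
    intro L R O
    simp only [Matrix.mul_assoc]
  simp only [sigmaMDFormula, deltaFormula]
  rw [h3, h]
  simp only [Matrix.mul_add, Matrix.add_mul, Matrix.transpose_mul, Matrix.transpose_neg,
    Matrix.neg_mul, Matrix.mul_neg, neg_neg, Matrix.mul_assoc]

/-- With `P̂` itself as the initial CCP estimator, `Σ_{K-MD} = L_K Δ_K L_K'`. -/
lemma sigmaMDFormula_equiv (OPP : Matrix ι ι ℝ) (OPg : Matrix ι γ ℝ) (Ogg : Matrix γ γ ℝ)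
    (hP : OPP.transpose = OPP) (W : ℕ → Matrix ι ι ℝ) (k : ℕ) :
    sigmaMDFormula A D C (blockVar OPP OPP OPP OPg OPg Ogg) W k
      = wlsMap A (W k) * deltaFormula A D C OPP OPg Ogg W k * (wlsMap A (W k)).transpose := by
  rw [sigmaMDFormula_uncorrelated OPP OPP OPg Ogg hP, sub_self, Matrix.mul_zero, Matrix.zero_mul,
    add_zero]

/-- The Gauss–Markov theorem: `(A' S⁻¹ A)⁻¹` is the least variance of a linear unbiased estimator. -/
lemma gaussMarkov (hA : A.rank = Fintype.card κ) {S : Matrix ι ι ℝ} (hS : S.PosDef)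
    {N : Matrix κ ι ℝ} (hN : N * A = 1) :
    (N * S * N.transpose - (A.transpose * S⁻¹ * A)⁻¹).PosSemidef := by
  have hM := posDef_transpose_mul_mul hA hS.inv
  set M := A.transpose * S⁻¹ * A with hMdef
  have hMs : M⁻¹.transpose = M⁻¹ := by simpa using hM.inv.isHermitian.eq
  have hSs : S⁻¹.transpose = S⁻¹ := by simpa using hS.inv.isHermitian.eq
  have hSi : S * S⁻¹ = 1 := Matrix.mul_nonsing_inv _ ((Matrix.isUnit_iff_isUnit_det _).1 hS.isUnit)
  have hSi' : S⁻¹ * S = 1 := Matrix.nonsing_inv_mul _ ((Matrix.isUnit_iff_isUnit_det _).1 hS.isUnit)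
  have hMi : M * M⁻¹ = 1 := Matrix.mul_nonsing_inv _ ((Matrix.isUnit_iff_isUnit_det _).1 hM.isUnit)
  have hN' : A.transpose * N.transpose = 1 := by
    rw [← Matrix.transpose_mul, hN, Matrix.transpose_one]
  -- `N S N' - M⁻¹` is the variance of the difference of the estimators `N` and `M⁻¹ A' S⁻¹`
  have h := hS.posSemidef.mul_mul_conjTranspose_same (N - M⁻¹ * A.transpose * S⁻¹)
  convert h using 1
  have e1 : (N - M⁻¹ * A.transpose * S⁻¹).conjTranspose = N.transpose - S⁻¹ * (A * M⁻¹) := by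
    rw [Matrix.conjTranspose_eq_transpose_of_trivial, Matrix.transpose_sub, Matrix.transpose_mul,
      Matrix.transpose_mul, hMs, hSs, Matrix.transpose_transpose]
  have e2 : (N - M⁻¹ * A.transpose * S⁻¹) * S = N * S - M⁻¹ * A.transpose := by
    rw [Matrix.sub_mul, Matrix.mul_assoc _ S⁻¹ S, hSi', Matrix.mul_one]
  have e3 : N * S * (S⁻¹ * (A * M⁻¹)) = M⁻¹ := by
    rw [Matrix.mul_assoc, ← Matrix.mul_assoc S, hSi, Matrix.one_mul, ← Matrix.mul_assoc, hN,
      Matrix.one_mul]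
  have e4 : M⁻¹ * A.transpose * N.transpose = M⁻¹ := by
    rw [Matrix.mul_assoc, hN', Matrix.mul_one]
  have e5 : M⁻¹ * A.transpose * (S⁻¹ * (A * M⁻¹)) = M⁻¹ := by
    have : M⁻¹ * A.transpose * (S⁻¹ * (A * M⁻¹)) = M⁻¹ * (M * M⁻¹) := by
      rw [hMdef]
      simp only [Matrix.mul_assoc]
    rw [this, hMi, Matrix.mul_one]
  rw [e1, e2, Matrix.mul_sub, Matrix.sub_mul, Matrix.sub_mul, e3, e4, e5]
  abel

lemma wlsMap_inv_variance (hA : A.rank = Fintype.card κ) {S : Matrix ι ι ℝ} (hS : S.PosDef) :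
    wlsMap A S⁻¹ * S * (wlsMap A S⁻¹).transpose = (A.transpose * S⁻¹ * A)⁻¹ := by
  have hN := wlsMap_mul hA hS.inv
  have hN' : A.transpose * (wlsMap A S⁻¹).transpose = 1 := by
    rw [← Matrix.transpose_mul, hN, Matrix.transpose_one]
  have hSi' : S⁻¹ * S = 1 := Matrix.nonsing_inv_mul _ ((Matrix.isUnit_iff_isUnit_det _).1 hS.isUnit)
  have h : wlsMap A S⁻¹ * S = (A.transpose * S⁻¹ * A)⁻¹ * A.transpose := by
    rw [wlsMap, Matrix.mul_assoc _ S⁻¹ S, hSi', Matrix.mul_one]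
  rw [h, Matrix.mul_assoc, hN', Matrix.mul_one]

/-- `Δ_K⁻¹ = B_K'⁻¹ Δ_1⁻¹ B_K⁻¹` and `B_K⁻¹ Ψ_α = Ψ_α`, so that the optimal variance does not depend on
`K` or on the earlier weights. -/
lemma optimal_variance_eq {B S : Matrix ι ι ℝ} (hB : IsUnit B.det) (hBA : B * A = A) :
    A.transpose * (B * S * B.transpose)⁻¹ * A = A.transpose * S⁻¹ * A := by
  have h : B⁻¹ * A = A := by
    conv_lhs => rw [← hBA, ← Matrix.mul_assoc, Matrix.nonsing_inv_mul _ hB, Matrix.one_mul]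
  have h' : A.transpose * B.transpose⁻¹ = A.transpose := by
    rw [← Matrix.transpose_nonsing_inv, ← Matrix.transpose_mul, h]
  rw [Matrix.mul_inv_rev, Matrix.mul_inv_rev, ← Matrix.mul_assoc, h', Matrix.mul_assoc,
    Matrix.mul_assoc, h, Matrix.mul_assoc]

lemma eq_zero_of_quadratic_nonneg {c e : ℝ} (h : ∀ s : ℝ, 0 ≤ c * s ^ 2 + 2 * e * s) : e = 0 := by
  have h1 := h (-e / (|c| + 1))
  have hc : 0 < |c| + 1 := by positivity
  have h2 : c * (-e / (|c| + 1)) ^ 2 + 2 * e * (-e / (|c| + 1))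
      = e ^ 2 * (c - 2 * (|c| + 1)) / (|c| + 1) ^ 2 := by
    field_simp
    ring
  rw [h2, le_div_iff₀ (by positivity), zero_mul] at h1
  have h3 := le_abs_self c
  have h4 : c - 2 * (|c| + 1) < 0 := by linarith [abs_nonneg c]
  by_contra he
  have : 0 < e ^ 2 := by positivity
  nlinarith

/-- If no mixture of `P̂` and `P̂₀` improves on `(P̂, ĝ)`, then `P̂₀ - P̂` is asymptotically uncorrelated
with `P̂` and with `ĝ` (the argument behind Hausman's test). -/
lemma uncorrelated_of_efficient {OPP OP0 O00 : Matrix ι ι ℝ} {OPg O0g : Matrix ι γ ℝ}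
    {Ogg : Matrix γ γ ℝ} (hP : OPP.transpose = OPP)
    (h : ∀ M : Matrix ι ι ℝ,
      ((Matrix.fromBlocks (1 - M) (Matrix.fromCols M 0) 0 (Matrix.fromCols 0 1) :
          Matrix (ι ⊕ γ) (ι ⊕ (ι ⊕ γ)) ℝ) * blockVar OPP OP0 O00 OPg O0g Ogg
        * (Matrix.fromBlocks (1 - M) (Matrix.fromCols M 0) 0 (Matrix.fromCols 0 1) :
          Matrix (ι ⊕ γ) (ι ⊕ (ι ⊕ γ)) ℝ).transpose
        - Matrix.fromBlocks OPP OPg OPg.transpose Ogg).PosSemidef) :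
    OP0 = OPP ∧ O0g = OPg ∧ (O00 - OPP).PosSemidef := by
  have key : ∀ M : Matrix ι ι ℝ,
      (Matrix.fromBlocks (1 - M) (Matrix.fromCols M 0) 0 (Matrix.fromCols 0 1) :
          Matrix (ι ⊕ γ) (ι ⊕ (ι ⊕ γ)) ℝ) * blockVar OPP OP0 O00 OPg O0g Ogg
        * (Matrix.fromBlocks (1 - M) (Matrix.fromCols M 0) 0 (Matrix.fromCols 0 1) :
          Matrix (ι ⊕ γ) (ι ⊕ (ι ⊕ γ)) ℝ).transpose
        - Matrix.fromBlocks OPP OPg OPg.transpose Ogg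
      = Matrix.fromBlocks (M * (OP0 - OPP).transpose + (OP0 - OPP) * M.transpose
          + M * (OPP - OP0 - OP0.transpose + O00) * M.transpose) (M * (O0g - OPg))
          ((O0g - OPg).transpose * M.transpose) 0 := by
    intro M
    have hb : ∀ (a a' : Matrix ι ι ℝ) (b b' : Matrix ι γ ℝ) (c c' : Matrix γ ι ℝ)
        (d d' : Matrix γ γ ℝ), Matrix.fromBlocks a b c d - Matrix.fromBlocks a' b' c' d'
          = Matrix.fromBlocks (a - a') (b - b') (c - c') (d - d') := by
      intro a a' b b' c c' d d'
      rw [sub_eq_add_neg, Matrix.fromBlocks_neg, Matrix.fromBlocks_add]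
      simp only [← sub_eq_add_neg]
    rw [Matrix.fromBlocks_transpose, blockVar, Matrix.fromBlocks_multiply, Matrix.fromBlocks_multiply,
      hb]
    simp only [Matrix.transpose_fromCols, Matrix.fromCols_mul_fromBlocks,
      Matrix.fromCols_mul_fromRows, Matrix.mul_fromCols, hP, Matrix.transpose_sub,
      Matrix.add_mul, Matrix.mul_add, Matrix.mul_sub, Matrix.sub_mul, Matrix.transpose_zero,
      Matrix.transpose_one, Matrix.mul_zero, Matrix.zero_mul, Matrix.one_mul,
      Matrix.mul_one, add_zero, zero_add, sub_self]
    congr 1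
    · abel
    · abel
    · abel
  replace h := fun M => key M ▸ h M
  have hP0 : OP0 = OPP := by
    rw [← sub_eq_zero]
    ext i j
    -- for `M = s E_{ij}` the diagonal entry of the difference of variances is quadratic in `s`
    refine eq_zero_of_quadratic_nonneg (c := (OPP - OP0 - OP0.transpose + O00) j j) fun s => ?_
    have h1 := (h (Matrix.single i j s)).diag_nonneg (i := Sum.inl i)
    rw [Matrix.fromBlocks_apply₁₁] at h1
    generalize OPP - OP0 - OP0.transpose + O00 = V at h1 ⊢
    simp only [Matrix.add_apply, Matrix.transpose_single, Matrix.mul_single_apply_same,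
      Matrix.single_mul_apply_same, Matrix.transpose_apply] at h1
    linarith
  refine ⟨hP0, ?_, ?_⟩
  · rw [← sub_eq_zero]
    ext i g
    -- a positive semidefinite matrix with a vanishing diagonal block has vanishing off-diagonal ones
    have h1 := ((h 1).submatrix ![Sum.inl i, Sum.inr g]).det_nonneg
    rw [Matrix.det_fin_two] at h1
    simp only [Matrix.submatrix_apply, Matrix.cons_val_zero, Matrix.cons_val_one,
      Matrix.fromBlocks_apply₁₁, Matrix.fromBlocks_apply₁₂, Matrix.fromBlocks_apply₂₁,
      Matrix.fromBlocks_apply₂₂, Matrix.zero_apply, mul_zero, Matrix.one_mul, Matrix.transpose_one,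
      Matrix.mul_one, Matrix.transpose_apply, zero_sub] at h1
    have h2 : (O0g - OPg) i g * (O0g - OPg) i g = 0 :=
      le_antisymm (by linarith) (mul_self_nonneg _)
    exact mul_self_eq_zero.1 h2
  · have h1 := (h 1).submatrix Sum.inl
    have h2 : (Matrix.fromBlocks ((1 : Matrix ι ι ℝ) * (OP0 - OPP).transpose
        + (OP0 - OPP) * (1 : Matrix ι ι ℝ).transpose
        + 1 * (OPP - OP0 - OP0.transpose + O00) * (1 : Matrix ι ι ℝ).transpose)
        ((1 : Matrix ι ι ℝ) * (O0g - OPg)) ((O0g - OPg).transpose * (1 : Matrix ι ι ℝ).transpose)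
        (0 : Matrix γ γ ℝ)).submatrix Sum.inl Sum.inl = O00 - OPP := by
      rw [hP0, hP]
      ext i j
      simp
      ring
    rwa [h2] at h1

end MatrixAlgebra

/-! ### One step of the iteration along an arbitrary filter -/

section Stage

open Asymptotics

variable {T Ea Ep Z Ex : Type*} {l : Filter T}

/-- Consistency of extremum estimators: every cluster point of the estimator in the compact parameter
space maximises the limit criterion. -/
lemma tendsto_argmax [PseudoMetricSpace Ep] [TopologicalSpace Ea] [TopologicalSpace Z]
    {Θ : Set Ea} {αstar : Ea} {zstar : Z} {Ψ : Ea → Z → Ep} {z : T → Z} {αhat : T → Ea}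
    (hΘ : IsCompact Θ) (hcont : ContinuousOn (fun α => Ψ α zstar) Θ)
    (hunif : TendstoUniformlyOn (fun z α => Ψ α z) (fun α => Ψ α zstar) (𝓝 zstar) Θ)
    (hαstar : αstar ∈ Θ) (hident : ∀ α ∈ Θ, Ψ α zstar = Ψ αstar zstar → α = αstar)
    {q : T → Ep → ℝ} {q₀ : Ep → ℝ}
    (hq : ∀ α ∈ Θ, Tendsto (fun x : T × Ep => q x.1 x.2) (l ×ˢ 𝓝 (Ψ α zstar))
      (𝓝 (q₀ (Ψ α zstar))))
    (hmax : ∀ α ∈ Θ, q₀ (Ψ αstar zstar) ≤ q₀ (Ψ α zstar) → Ψ α zstar = Ψ αstar zstar)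
    (hz : Tendsto z l (𝓝 zstar))
    (hest : ∀ᶠ t in l, αhat t ∈ Θ ∧ IsMaxOn (fun α => q t (Ψ α (z t))) Θ (αhat t)) :
    Tendsto αhat l (𝓝 αstar) := by
  refine hΘ.tendsto_nhds_of_unique_mapClusterPt (hest.mono fun t h => h.1) fun α hα hcl => ?_
  obtain ⟨U, hU, hαU⟩ := mapClusterPt_iff_ultrafilter.1 hcl
  have hUz : Tendsto z U (𝓝 zstar) := hz.mono_left hU
  have hUe := hest.filter_mono hU
  have hψ : ∀ (β : T → Ea) (β₀ : Ea), β₀ ∈ Θ → (∀ᶠ t in (U : Filter T), β t ∈ Θ) →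
      Tendsto β U (𝓝 β₀) → Tendsto (fun t => Ψ (β t) (z t)) U (𝓝 (Ψ β₀ zstar)) := by
    intro β β₀ hβ₀ hβ hββ
    have h1 : Tendsto (fun t => Ψ (β t) zstar) U (𝓝 (Ψ β₀ zstar)) :=
      (hcont β₀ hβ₀).tendsto.comp (tendsto_nhdsWithin_iff.2 ⟨hββ, hβ⟩)
    refine Metric.tendsto_nhds.2 fun ε hε => ?_
    filter_upwards [Metric.tendsto_nhds.1 h1 _ (half_pos hε), hβ,
      hUz.eventually (Metric.tendstoUniformlyOn_iff.1 hunif _ (half_pos hε))] with t h2 h3 h4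
    calc _ ≤ dist (Ψ (β t) (z t)) (Ψ (β t) zstar) + dist (Ψ (β t) zstar) (Ψ β₀ zstar) :=
          dist_triangle _ _ _
      _ < ε / 2 + ε / 2 := add_lt_add (by rw [dist_comm]; exact h4 _ h3) h2
      _ = ε := add_halves ε
  have hlim : ∀ (β : T → Ea) (β₀ : Ea), β₀ ∈ Θ → (∀ᶠ t in (U : Filter T), β t ∈ Θ) →
      Tendsto β U (𝓝 β₀) → Tendsto (fun t => q t (Ψ (β t) (z t))) U (𝓝 (q₀ (Ψ β₀ zstar))) :=
    fun β β₀ hβ₀ hβ hββ => (hq β₀ hβ₀).comp ((tendsto_id'.2 hU).prodMk (hψ β β₀ hβ₀ hβ hββ))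
  refine hident α hα (hmax α hα ?_)
  refine le_of_tendsto_of_tendsto (hlim (fun _ => αstar) αstar hαstar (.of_forall fun _ => hαstar)
    tendsto_const_nhds) (hlim αhat α hα (hUe.mono fun t h => h.1) hαU) ?_
  filter_upwards [hUe] with t ht using ht.2 hαstar

/-- Solving a linearised estimating equation `H (y - s) = 0`, `s ≈ A a + d`, for `a`: the remainder
`o(‖a‖)` is absorbed because `a ↦ H₀ A a` has a left inverse `G`. -/
lemma isLittleO_of_estimating_equation {Ea Ep Eb : Type*}
    [NormedAddCommGroup Ea] [NormedSpace ℝ Ea] [NormedAddCommGroup Ep] [NormedSpace ℝ Ep]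
    [NormedAddCommGroup Eb] [NormedSpace ℝ Eb] [NormedAddCommGroup Ex]
    {A : Ea →L[ℝ] Ep} {H₀ : Ep →L[ℝ] Eb} {G : Eb →L[ℝ] Ea} (hG : ∀ x, G (H₀ (A x)) = x)
    {H : T → Ep →L[ℝ] Eb} (hH : Tendsto H l (𝓝 H₀)) {a : T → Ea} {y s d : T → Ep} {ξ : T → Ex}
    (hfoc : ∀ᶠ t in l, H t (y t - s t) = 0)
    (hs : (fun t => s t - A (a t) - d t) =o[l] fun t => ‖a t‖ + ‖ξ t‖)
    (hy : y =O[l] ξ) (hd : d =O[l] ξ) :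
    (fun t => a t - G (H₀ (y t - d t))) =o[l] ξ ∧
      (fun t => s t - (A (G (H₀ (y t - d t))) + d t)) =o[l] ξ := by
  have hax : a =O[l] fun t => ‖a t‖ + ‖ξ t‖ := by
    refine IsBigO.of_bound 1 (.of_forall fun t => ?_)
    rw [one_mul, Real.norm_of_nonneg (by positivity)]
    exact le_add_of_nonneg_right (norm_nonneg _)
  have hξx : ξ =O[l] fun t => ‖a t‖ + ‖ξ t‖ := by
    refine IsBigO.of_bound 1 (.of_forall fun t => ?_)
    rw [one_mul, Real.norm_of_nonneg (by positivity)]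
    exact le_add_of_nonneg_left (norm_nonneg _)
  have hsO : s =O[l] fun t => ‖a t‖ + ‖ξ t‖ := by
    refine ((hs.isBigO.add ((A.isBigO_comp a l).trans hax)).add (hd.trans hξx)).congr_left
      fun t => ?_
    abel
  have hHo : (fun t => (H₀ - H t) (y t - s t)) =o[l] fun t => ‖a t‖ + ‖ξ t‖ := by
    have h0 : Tendsto (fun t => ‖H₀ - H t‖) l (𝓝 0) := by
      have := (tendsto_const_nhds (x := H₀)).sub hH
      rw [sub_self] at this
      exact tendsto_zero_iff_norm_tendsto_zero.1 this
    have h1 : (fun t => ‖H₀ - H t‖ * ‖y t - s t‖) =o[l]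
        fun t => (1 : ℝ) * (‖a t‖ + ‖ξ t‖) :=
      ((isLittleO_one_iff ℝ).2 h0).mul_isBigO ((hy.trans hξx).sub hsO).norm_left
    simp only [one_mul] at h1
    refine IsBigO.trans_isLittleO (IsBigO.of_bound 1 (.of_forall fun t => ?_)) h1
    rw [one_mul, Real.norm_of_nonneg (by positivity)]
    exact (H₀ - H t).le_opNorm _
  have h1 : (fun t => a t - G (H₀ (y t - d t))) =o[l] fun t => ‖a t‖ + ‖ξ t‖ := by
    have h2 := (((G ∘L H₀).isBigO_comp _ l).trans_isLittleO hs).add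
      ((G.isBigO_comp _ l).trans_isLittleO hHo)
    refine h2.neg_left.congr' ?_ .rfl
    filter_upwards [hfoc] with t ht
    have h3 : G ((H₀ - H t) (y t - s t)) = G (H₀ (y t - s t)) := by
      rw [sub_apply, ht, sub_zero]
    rw [h3, ContinuousLinearMap.comp_apply]
    simp only [map_sub, hG]
    abel
  -- a remainder `o(‖a‖ + ‖ξ‖)` forces `a = O(ξ)`, so that it is in fact `o(ξ)`
  have ha : a =O[l] ξ := by
    have hL : (fun t => G (H₀ (y t - d t))) =O[l] ξ :=
      ((G ∘L H₀).isBigO_comp _ l).trans (hy.sub hd)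
    obtain ⟨c, hc⟩ := hL.bound
    refine IsBigO.of_bound (2 * c + 1) ?_
    filter_upwards [hc, h1.def one_half_pos] with t h2 h3
    rw [Real.norm_of_nonneg (by positivity)] at h3
    have h4 := norm_le_norm_add_norm_sub' (a t) (G (H₀ (y t - d t)))
    linarith
  have hx : (fun t => ‖a t‖ + ‖ξ t‖) =O[l] ξ := ha.norm_left.add (isBigO_refl ξ l).norm_left
  have h5 := h1.trans_isBigO hx
  refine ⟨h5, ?_⟩
  refine ((hs.trans_isBigO hx).add ((A.isBigO_comp _ l).trans_isLittleO h5)).congr_left fun t => ?_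
  simp only [map_sub]
  abel

variable [NormedAddCommGroup Ea] [InnerProductSpace ℝ Ea] [CompleteSpace Ea]
  [NormedAddCommGroup Ep] [InnerProductSpace ℝ Ep] [CompleteSpace Ep]
  [NormedAddCommGroup Z] [NormedSpace ℝ Z] [NormedAddCommGroup Ex]

/-- A sequence of sample criteria `q t`, functions of the model probabilities, that is regular along
`l` for estimating `pstar` from `phat`. On the set `S` of candidate probabilities it converges,
locally uniformly, to a limit criterion that only `pstar` maximises; and near `pstar` its gradient is,
up to a nonzero factor, a weight operator applied to `phat - p`, the weights converging to `M₀`. -/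
structure RegularCriterion (l : Filter T) (S : Set Ep) (pstar : Ep) (phat : T → Ep)
    (q : T → Ep → ℝ) (M₀ : Ep →L[ℝ] Ep) : Prop where
  limit : ∃ q₀ : Ep → ℝ,
    (∀ p ∈ S, Tendsto (fun x : T × Ep => q x.1 x.2) (l ×ˢ 𝓝 p) (𝓝 (q₀ p))) ∧
    ∀ p ∈ S, q₀ pstar ≤ q₀ p → p = pstar
  gradient : ∃ c : ℝ, c ≠ 0 ∧ ∃ M : T → Ep → Ep →L[ℝ] Ep,
    Tendsto (fun x : T × Ep => M x.1 x.2) (l ×ˢ 𝓝 pstar) (𝓝 M₀) ∧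
    ∀ᶠ x in l ×ˢ 𝓝 pstar,
      HasFDerivAt (q x.1) (c • innerSL ℝ (M x.1 x.2 (phat x.1 - x.2))) x.2

variable {Θ : Set Ea} {αstar : Ea} {zstar : Z} {Ψ : Ea → Z → Ep} {z : T → Z} {αhat : T → Ea}

/-- One step of the iteration: the maximiser of a regular criterion is consistent and is, to first
order, the weighted least-squares solution of the linearised moment condition. Here `A` and `B` are the
partial derivatives of `Ψ`, and `G` inverts `A' M₀ A`. -/
lemma stage_expansion (hΘ : IsCompact Θ) (hcont : ContinuousOn (fun α => Ψ α zstar) Θ)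
    (hunif : TendstoUniformlyOn (fun z α => Ψ α z) (fun α => Ψ α zstar) (𝓝 zstar) Θ)
    (hαstar : αstar ∈ interior Θ) (hident : ∀ α ∈ Θ, Ψ α zstar = Ψ αstar zstar → α = αstar)
    (hsmooth : ContDiffAt ℝ 2 (fun x : Ea × Z => Ψ x.1 x.2) (αstar, zstar))
    {phat : T → Ep} {q : T → Ep → ℝ} {M₀ : Ep →L[ℝ] Ep}
    (hq : RegularCriterion l ((fun α => Ψ α zstar) '' Θ) (Ψ αstar zstar) phat q M₀)
    {A : Ea →L[ℝ] Ep}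
    (hA : A = fderiv ℝ (fun x : Ea × Z => Ψ x.1 x.2) (αstar, zstar) ∘L .inl ℝ Ea Z)
    {B : Z →L[ℝ] Ep}
    (hB : B = fderiv ℝ (fun x : Ea × Z => Ψ x.1 x.2) (αstar, zstar) ∘L .inr ℝ Ea Z)
    {G : Ea →L[ℝ] Ea} (hG : ∀ x, G (A.adjoint (M₀ (A x))) = x)
    (hest : ∀ᶠ t in l, αhat t ∈ Θ ∧ IsMaxOn (fun α => q t (Ψ α (z t))) Θ (αhat t))
    {ξ : T → Ex} (hz : Tendsto z l (𝓝 zstar)) (hzξ : (fun t => z t - zstar) =O[l] ξ)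
    (hphat : (fun t => phat t - Ψ αstar zstar) =O[l] ξ) :
    (fun t => αhat t - αstar - G (A.adjoint (M₀ (phat t - Ψ αstar zstar - B (z t - zstar)))))
        =o[l] ξ ∧
      (fun t => Ψ (αhat t) (z t) - Ψ αstar zstar
        - (A (G (A.adjoint (M₀ (phat t - Ψ αstar zstar - B (z t - zstar))))) + B (z t - zstar)))
        =o[l] ξ := by
  obtain ⟨q₀, hq₀, hq₁⟩ := hq.limit
  obtain ⟨c, hc, M, hM, hgrad⟩ := hq.gradient
  have hαhat : Tendsto αhat l (𝓝 αstar) :=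
    tendsto_argmax hΘ hcont hunif (interior_subset hαstar) hident
      (fun α hα => hq₀ _ ⟨α, hα, rfl⟩) (fun α hα => hq₁ _ ⟨α, hα, rfl⟩) hz hest
  have hαz : Tendsto (fun t => (αhat t, z t)) l (𝓝 (αstar, zstar)) := hαhat.prodMk_nhds hz
  have hψ : Tendsto (fun t => Ψ (αhat t) (z t)) l (𝓝 (Ψ αstar zstar)) :=
    hsmooth.continuousAt.tendsto.comp hαz
  have hd : HasFDerivAt (fun x : Ea × Z => Ψ x.1 x.2)
      (fderiv ℝ (fun x : Ea × Z => Ψ x.1 x.2) (αstar, zstar)) (αstar, zstar) :=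
    (hsmooth.differentiableAt (by norm_num)).hasFDerivAt
  set F := fderiv ℝ (fun x : Ea × Z => Ψ x.1 x.2) with hF
  have hFc : ContinuousAt F (αstar, zstar) :=
    (hsmooth.fderiv_right (m := 0) (by norm_num)).continuousAt
  have hdiff : ∀ᶠ x in 𝓝 (αstar, zstar),
      DifferentiableAt ℝ (fun x : Ea × Z => Ψ x.1 x.2) x := by
    filter_upwards [hsmooth.eventually (by simp)] with x hx
    exact hx.differentiableAt (by norm_num)
  -- the derivative of `Ψ` in the parameter, along the estimators
  let J : T → Ea →L[ℝ] Ep := fun t => F (αhat t, z t) ∘L .inl ℝ Ea Z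
  have hJ : Tendsto J l (𝓝 A) := by
    rw [hA]
    exact ((ContinuousLinearMap.compL ℝ Ea (Ea × Z) Ep).flip
      (.inl ℝ Ea Z)).continuous.continuousAt.tendsto.comp (hFc.tendsto.comp hαz)
  have hprod : Tendsto (fun t => (t, Ψ (αhat t) (z t))) l (l ×ˢ 𝓝 (Ψ αstar zstar)) :=
    tendsto_id.prodMk hψ
  let H : T → Ep →L[ℝ] Ea := fun t => (J t).adjoint ∘L M t (Ψ (αhat t) (z t))
  have hH : Tendsto H l (𝓝 (A.adjoint ∘L M₀)) := by
    have h1 : Tendsto (fun t => (J t).adjoint) l (𝓝 A.adjoint) :=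
      (ContinuousLinearMap.adjoint (𝕜 := ℝ) (E := Ea) (F := Ep)).continuous.continuousAt.tendsto.comp
        hJ
    have h2 : Tendsto (fun t => M t (Ψ (αhat t) (z t))) l (𝓝 M₀) := hM.comp hprod
    have h3 := (isBoundedBilinearMap_comp (𝕜 := ℝ) (E := Ep) (F := Ep) (G := Ea)).continuous
    exact h3.continuousAt.tendsto.comp (h1.prodMk_nhds h2)
  refine isLittleO_of_estimating_equation (H₀ := A.adjoint ∘L M₀) (H := H) (G := G)
    (A := A) (a := fun t => αhat t - αstar) (y := fun t => phat t - Ψ αstar zstar)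
    (s := fun t => Ψ (αhat t) (z t) - Ψ αstar zstar) (d := fun t => B (z t - zstar)) (ξ := ξ)
    hG hH ?_ ?_ hphat ((B.isBigO_comp _ l).trans hzξ)
  · filter_upwards [hest, hαhat.eventually (isOpen_interior.mem_nhds hαstar), hαz.eventually hdiff,
      hprod.eventually hgrad] with t h1 h2 h3 h4
    -- the first-order condition at an interior maximiser
    have hloc : IsLocalMax (fun α => q t (Ψ α (z t))) (αhat t) :=
      h1.2.isLocalMax (mem_interior_iff_mem_nhds.1 h2)
    have h5 : HasFDerivAt (fun α => Ψ α (z t)) (J t) (αhat t) :=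
      HasFDerivAt.comp (f := fun α => (α, z t)) (αhat t) h3.hasFDerivAt
        (hasFDerivAt_prodMk_left (αhat t) (z t))
    have h6 := hloc.hasFDerivAt_eq_zero (HasFDerivAt.comp (αhat t) h4 h5)
    rw [sub_sub_sub_cancel_right]
    refine ext_inner_right ℝ fun v => ?_
    have h7 := DFunLike.congr_fun h6 v
    simp only [ContinuousLinearMap.comp_apply, smul_apply, innerSL_apply_apply,
      smul_eq_mul, zero_apply, mul_eq_zero, hc, false_or] at h7
    simp only [H, ContinuousLinearMap.comp_apply, ContinuousLinearMap.adjoint_inner_left, h7,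
      inner_zero_left]
  · have h1 := hd.isLittleO.comp_tendsto hαz
    have h2 : (fun t => (αhat t, z t) - (αstar, zstar)) =O[l]
        fun t => ‖αhat t - αstar‖ + ‖ξ t‖ := by
      refine IsBigO.prod_left (f' := fun t => αhat t - αstar) (g' := fun t => z t - zstar) ?_ ?_
      · refine IsBigO.of_bound 1 (.of_forall fun t => ?_)
        rw [one_mul, Real.norm_of_nonneg (by positivity)]
        exact le_add_of_nonneg_right (norm_nonneg _)
      · refine hzξ.trans (IsBigO.of_bound 1 (.of_forall fun t => ?_))
        rw [one_mul, Real.norm_of_nonneg (by positivity)]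
        exact le_add_of_nonneg_left (norm_nonneg _)
    refine (h1.trans_isBigO h2).congr_left fun t => ?_
    simp only [Function.comp_apply, hA, hB, ContinuousLinearMap.comp_apply,
      ContinuousLinearMap.inl_apply, ContinuousLinearMap.inr_apply]
    rw [sub_sub _ (F (αstar, zstar) _) (F (αstar, zstar) _), ← map_add]
    simp

end Stage

/-! ### Asymptotic expansion of the `K`-stage estimator -/

lemma toEuclideanLin_jacobian {ι κ : Type*} [Fintype ι] [Fintype κ] [DecidableEq κ]
    (f : EuclideanSpace ℝ κ → EuclideanSpace ℝ ι) (x v : EuclideanSpace ℝ κ) :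
    Matrix.toEuclideanLin (jacobian f x) v = fderiv ℝ f x v := by
  have hv : v = ∑ k, v k • EuclideanSpace.single k (1 : ℝ) := by
    ext k
    simp [Pi.single_apply]
  ext i
  conv_rhs => rw [hv]
  simp [jacobian, Matrix.toLpLin_apply, Matrix.mulVec, dotProduct, mul_comm]

lemma toEuclideanLin_mul_apply {ι κ δ : Type*} [Fintype ι] [Fintype κ] [DecidableEq κ] [Fintype δ]
    [DecidableEq δ] (M : Matrix ι κ ℝ) (N : Matrix κ δ ℝ) (v : EuclideanSpace ℝ δ) :
    Matrix.toEuclideanLin (M * N) v = Matrix.toEuclideanLin M (Matrix.toEuclideanLin N v) := by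
  simp [Matrix.toLpLin_apply]

lemma toEuclideanLin_one_apply {ι : Type*} [Fintype ι] [DecidableEq ι] (v : EuclideanSpace ℝ ι) :
    Matrix.toEuclideanLin (1 : Matrix ι ι ℝ) v = v := by
  simp

lemma toEuclideanLin_add_apply {ι κ : Type*} [Fintype κ] [DecidableEq κ] (M N : Matrix ι κ ℝ)
    (v : EuclideanSpace ℝ κ) : Matrix.toEuclideanLin (M + N) v
      = Matrix.toEuclideanLin M v + Matrix.toEuclideanLin N v := by
  rw [map_add, LinearMap.add_apply]

lemma toEuclideanLin_sub_apply {ι κ : Type*} [Fintype κ] [DecidableEq κ] (M N : Matrix ι κ ℝ)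
    (v : EuclideanSpace ℝ κ) : Matrix.toEuclideanLin (M - N) v
      = Matrix.toEuclideanLin M v - Matrix.toEuclideanLin N v := by
  rw [map_sub, LinearMap.sub_apply]

lemma toEuclideanLin_fromCols {ι κ δ : Type*} [Fintype κ] [Fintype δ]
    [DecidableEq κ] [DecidableEq δ] (M : Matrix ι κ ℝ) (N : Matrix ι δ ℝ)
    (u : EuclideanSpace ℝ κ) (v : EuclideanSpace ℝ δ) :
    Matrix.toEuclideanLin (Matrix.fromCols M N) (WithLp.toLp 2 (Sum.elim u v))
      = Matrix.toEuclideanLin M u + Matrix.toEuclideanLin N v := by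
  ext i
  simp [Matrix.toLpLin_apply, Matrix.fromCols_mulVec]

section Phi

variable {ι κ γ : Type*} [Fintype ι] [DecidableEq ι] [Fintype κ] [DecidableEq κ]
  [Fintype γ] [DecidableEq γ]

/-- The matrix of the asymptotic linear representation of `P̂_{k-1} - P*` in terms of the errors of
`(P̂, P̂₀, ĝ)`. -/
def phiRow (A : Matrix ι κ ℝ) (D : Matrix ι ι ℝ) (C : Matrix ι γ ℝ) (W : ℕ → Matrix ι ι ℝ) (k : ℕ) :
    Matrix ι (ι ⊕ (ι ⊕ γ)) ℝ :=
  Matrix.fromCols (phiP A D W k) (Matrix.fromCols (phi0 A D W k) (phiG A D W k * C))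

/-- The matrix `R_k` of the moment of step `k` in terms of the errors of `(P̂, P̂₀, ĝ)`. -/
def momentRow (A : Matrix ι κ ℝ) (D : Matrix ι ι ℝ) (C : Matrix ι γ ℝ) (W : ℕ → Matrix ι ι ℝ)
    (k : ℕ) : Matrix ι (ι ⊕ (ι ⊕ γ)) ℝ :=
  Matrix.fromCols (1 - D * phiP A D W k)
    (Matrix.fromCols (-(D * phi0 A D W k)) (-((1 + D * phiG A D W k) * C)))

/-- The matrix extracting the error of `ĝ` from the errors of `(P̂, P̂₀, ĝ)`. -/
def gRow (ι γ : Type*) [DecidableEq γ] : Matrix γ (ι ⊕ (ι ⊕ γ)) ℝ :=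
  Matrix.fromCols 0 (Matrix.fromCols 0 1)

variable {A : Matrix ι κ ℝ} {D : Matrix ι ι ℝ} {C : Matrix ι γ ℝ}

lemma mul_phiRow_add (W : ℕ → Matrix ι ι ℝ) (k : ℕ) :
    D * phiRow A D C W k + C * gRow ι γ = Matrix.fromCols (D * phiP A D W k)
      (Matrix.fromCols (D * phi0 A D W k) ((1 + D * phiG A D W k) * C)) := by
  rw [phiRow, gRow, Matrix.mul_fromCols, Matrix.mul_fromCols, Matrix.mul_fromCols,
    Matrix.mul_fromCols]
  ext i (j | j | j)
  · simp
  · simp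
  · simp [Matrix.add_mul, Matrix.mul_assoc]
    ring

lemma momentRow_eq (W : ℕ → Matrix ι ι ℝ) (k : ℕ) :
    momentRow A D C W k = Matrix.fromCols 1 0 - (D * phiRow A D C W k + C * gRow ι γ) := by
  rw [mul_phiRow_add, momentRow]
  ext i (j | j | j) <;> simp

lemma phiRow_add_two (W : ℕ → Matrix ι ι ℝ) (k : ℕ) :
    phiRow A D C W (k + 2) = A * wlsMap A (W (k + 1)) * momentRow A D C W (k + 1)
      + (D * phiRow A D C W (k + 1) + C * gRow ι γ) := by
  have h1 : phiP A D W (k + 2) = A * wlsMap A (W (k + 1)) * (1 - D * phiP A D W (k + 1))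
      + D * phiP A D W (k + 1) := by
    rw [phiP]
    simp only [Matrix.sub_mul, Matrix.mul_sub, Matrix.one_mul, Matrix.mul_one, Matrix.mul_assoc]
    abel
  have h2 : phi0 A D W (k + 2) = A * wlsMap A (W (k + 1)) * (-(D * phi0 A D W (k + 1)))
      + D * phi0 A D W (k + 1) := by
    rw [phi0]
    simp only [Matrix.sub_mul, Matrix.mul_neg, Matrix.one_mul, Matrix.mul_assoc]
    abel
  have h3 : phiG A D W (k + 2) * C
      = A * wlsMap A (W (k + 1)) * (-((1 + D * phiG A D W (k + 1)) * C))
        + (1 + D * phiG A D W (k + 1)) * C := by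
    rw [phiG]
    simp only [Matrix.sub_mul, Matrix.mul_neg, Matrix.one_mul, Matrix.mul_assoc]
    abel
  rw [mul_phiRow_add, phiRow, momentRow, Matrix.mul_fromCols, Matrix.mul_fromCols, h1, h2, h3]
  ext i (j | j | j) <;> simp

lemma wlsMap_apply_eq (A : Matrix ι κ ℝ) (V : Matrix ι ι ℝ) (v : EuclideanSpace ℝ ι) :
    Matrix.toEuclideanLin (A.transpose * V * A)⁻¹
        (Matrix.toEuclideanLin A.transpose (Matrix.toEuclideanLin V v))
      = Matrix.toEuclideanLin (wlsMap A V) v := by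
  rw [wlsMap, toEuclideanLin_mul_apply, toEuclideanLin_mul_apply]

open Asymptotics

lemma toEuclideanLin_isBigO {T : Type*} {l : Filter T} (M : Matrix ι κ ℝ)
    (f : T → EuclideanSpace ℝ κ) : (fun t => Matrix.toEuclideanLin M (f t)) =O[l] f :=
  (Matrix.toEuclideanLin M).toContinuousLinearMap.isBigO_comp f l

/-- One step of the iteration in coordinates: from the asymptotic linear representation of the CCP
estimator entering the step to those of the parameter estimator and of the updated CCP estimator. -/
lemma stage_expansion_matrix {T : Type*} {l : Filter T} {Θ : Set (EuclideanSpace ℝ κ)}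
    {αstar : EuclideanSpace ℝ κ} {gstar : EuclideanSpace ℝ γ} {pstar : EuclideanSpace ℝ ι}
    {Ψ : EuclideanSpace ℝ κ → EuclideanSpace ℝ γ × EuclideanSpace ℝ ι → EuclideanSpace ℝ ι}
    (hΘ : IsCompact Θ) (hcont : ContinuousOn (fun α => Ψ α (gstar, pstar)) Θ)
    (hunif : TendstoUniformlyOn (fun z α => Ψ α z) (fun α => Ψ α (gstar, pstar))
      (𝓝 (gstar, pstar)) Θ)
    (hαstar : αstar ∈ interior Θ)
    (hident : ∀ α ∈ Θ, Ψ α (gstar, pstar) = pstar ↔ α = αstar)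
    (hsmooth : ContDiffAt ℝ 2
      (fun x : EuclideanSpace ℝ κ × EuclideanSpace ℝ γ × EuclideanSpace ℝ ι => Ψ x.1 x.2)
      (αstar, gstar, pstar))
    (hderiv : ∀ a g P, fderiv ℝ
      (fun x : EuclideanSpace ℝ κ × EuclideanSpace ℝ γ × EuclideanSpace ℝ ι => Ψ x.1 x.2)
      (αstar, gstar, pstar) (a, g, P) = Matrix.toEuclideanLin A a + Matrix.toEuclideanLin C g
        + Matrix.toEuclideanLin D P)
    (hrank : A.rank = Fintype.card κ) {W : ℕ → Matrix ι ι ℝ} {k : ℕ} (hW : (W (k + 1)).PosDef)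
    {phat P : T → EuclideanSpace ℝ ι} {ghat : T → EuclideanSpace ℝ γ}
    {αhat : T → EuclideanSpace ℝ κ} {q : T → EuclideanSpace ℝ ι → ℝ}
    (hq : RegularCriterion l ((fun α => Ψ α (gstar, pstar)) '' Θ) pstar phat q
      (Matrix.toEuclideanCLM (𝕜 := ℝ) (W (k + 1))))
    (hest : ∀ᶠ t in l, αhat t ∈ Θ ∧ IsMaxOn (fun α => q t (Ψ α (ghat t, P t))) Θ (αhat t))
    {ξ : T → EuclideanSpace ℝ (ι ⊕ (ι ⊕ γ))} (hξ : Tendsto ξ l (𝓝 0))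
    (hy : ∀ t, phat t - pstar = Matrix.toEuclideanLin (Matrix.fromCols 1 0) (ξ t))
    (hg : ∀ t, ghat t - gstar = Matrix.toEuclideanLin (gRow ι γ) (ξ t))
    (hP : (fun t => P t - pstar - Matrix.toEuclideanLin (phiRow A D C W (k + 1)) (ξ t)) =o[l] ξ) :
    (fun t => αhat t - αstar - Matrix.toEuclideanLin
        (wlsMap A (W (k + 1)) * momentRow A D C W (k + 1)) (ξ t)) =o[l] ξ ∧
      (fun t => Ψ (αhat t) (ghat t, P t) - pstar
        - Matrix.toEuclideanLin (phiRow A D C W (k + 2)) (ξ t)) =o[l] ξ := by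
  have hstar : Ψ αstar (gstar, pstar) = pstar := (hident _ (interior_subset hαstar)).2 rfl
  obtain ⟨F, hF⟩ : ∃ F, F = fderiv ℝ
      (fun x : EuclideanSpace ℝ κ × EuclideanSpace ℝ γ × EuclideanSpace ℝ ι => Ψ x.1 x.2)
      (αstar, gstar, pstar) := ⟨_, rfl⟩
  rw [← hF] at hderiv
  obtain ⟨A', hA'⟩ : ∃ A', A' = F ∘L .inl ℝ _ _ := ⟨_, rfl⟩
  obtain ⟨B, hB⟩ : ∃ B, B = F ∘L .inr ℝ _ _ := ⟨_, rfl⟩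
  have hA_apply : ∀ v, A' v = Matrix.toEuclideanLin A v := by
    intro v
    rw [hA', ContinuousLinearMap.comp_apply, ContinuousLinearMap.inl_apply, ← Prod.mk_zero_zero,
      hderiv, map_zero, map_zero, add_zero, add_zero]
  have hB_apply : ∀ v w, B (v, w) = Matrix.toEuclideanLin C v + Matrix.toEuclideanLin D w := by
    intro v w
    rw [hB, ContinuousLinearMap.comp_apply, ContinuousLinearMap.inr_apply, hderiv, map_zero, zero_add]
  have hadj : ∀ v, A'.adjoint v = Matrix.toEuclideanLin A.transpose v := by
    intro v
    refine ext_inner_right ℝ fun x => ?_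
    rw [ContinuousLinearMap.adjoint_inner_left, hA_apply, inner_toEuclideanLin,
      Matrix.transpose_transpose]
  obtain ⟨V, hV⟩ : ∃ V, V = W (k + 1) := ⟨_, rfl⟩
  rw [← hV] at hW hq ⊢
  obtain ⟨G, hGdef⟩ : ∃ G, G = (Matrix.toEuclideanLin (A.transpose * V * A)⁻¹).toContinuousLinearMap :=
    ⟨_, rfl⟩
  have hL : ∀ v, G (A'.adjoint (Matrix.toEuclideanCLM (𝕜 := ℝ) V v))
      = Matrix.toEuclideanLin (wlsMap A V) v := by
    intro v
    rw [hadj, ← wlsMap_apply_eq, hGdef]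
    rfl
  have hG : ∀ x, G (A'.adjoint (Matrix.toEuclideanCLM (𝕜 := ℝ) V (A' x))) = x := by
    intro x
    rw [hL, hA_apply, ← toEuclideanLin_mul_apply, wlsMap_mul hrank hW, toEuclideanLin_one_apply]
  have hyO : (fun t => phat t - pstar) =O[l] ξ :=
    (toEuclideanLin_isBigO _ ξ).congr_left fun t => (hy t).symm
  have hgO : (fun t => ghat t - gstar) =O[l] ξ :=
    (toEuclideanLin_isBigO _ ξ).congr_left fun t => (hg t).symm
  have hPO : (fun t => P t - pstar) =O[l] ξ :=
    (hP.isBigO.add (toEuclideanLin_isBigO (phiRow A D C W (k + 1)) ξ)).congr_left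
      fun t => sub_add_cancel _ _
  have hgt : Tendsto ghat l (𝓝 gstar) := by
    simpa using (hgO.trans_tendsto hξ).add_const gstar
  have hPt : Tendsto P l (𝓝 pstar) := by
    simpa using (hPO.trans_tendsto hξ).add_const pstar
  have key := stage_expansion (z := fun t => (ghat t, P t)) (G := G) (q := q)
    hΘ hcont hunif hαstar (fun α hα h => (hident α hα).1 (h.trans hstar)) hsmooth
    (hstar.symm ▸ hq) (hA'.trans (hF ▸ rfl)) (hB.trans (hF ▸ rfl)) hG hest
    (hgt.prodMk_nhds hPt) (hgO.prod_left hPO) (hstar.symm ▸ hyO)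
  simp only [hstar, hL, hA_apply] at key
  have hrem : (fun t => Matrix.toEuclideanLin D (P t - pstar
      - Matrix.toEuclideanLin (phiRow A D C W (k + 1)) (ξ t))) =o[l] ξ :=
    (toEuclideanLin_isBigO D _).trans_isLittleO hP
  have hd : ∀ t, B ((ghat t, P t) - (gstar, pstar))
      = Matrix.toEuclideanLin (D * phiRow A D C W (k + 1) + C * gRow ι γ) (ξ t)
        + Matrix.toEuclideanLin D (P t - pstar
          - Matrix.toEuclideanLin (phiRow A D C W (k + 1)) (ξ t)) := by
    intro t
    rw [Prod.mk_sub_mk, hB_apply, hg, toEuclideanLin_add_apply,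
      toEuclideanLin_mul_apply, toEuclideanLin_mul_apply, map_sub _ (_ - pstar)]
    abel
  have hm : ∀ t, phat t - pstar - B ((ghat t, P t) - (gstar, pstar))
      = Matrix.toEuclideanLin (momentRow A D C W (k + 1)) (ξ t)
        - Matrix.toEuclideanLin D (P t - pstar
          - Matrix.toEuclideanLin (phiRow A D C W (k + 1)) (ξ t)) := by
    intro t
    rw [hd, hy, momentRow_eq, toEuclideanLin_sub_apply]
    abel
  have hrem2 := (toEuclideanLin_isBigO (wlsMap A V) _).trans_isLittleO hrem
  have hrem3 := (toEuclideanLin_isBigO A _).trans_isLittleO hrem2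
  constructor
  · refine (key.1.sub hrem2).congr_left fun t => ?_
    rw [hm, map_sub (Matrix.toEuclideanLin (wlsMap A V)), toEuclideanLin_mul_apply]
    abel
  · refine ((key.2.sub hrem3).add hrem).congr_left fun t => ?_
    rw [hm, hd, phiRow_add_two, map_sub (Matrix.toEuclideanLin (wlsMap A V)),
      map_sub (Matrix.toEuclideanLin A), toEuclideanLin_add_apply _ (_ + _), ← hV,
      toEuclideanLin_mul_apply, toEuclideanLin_mul_apply]
    abel

end Phi

namespace Environment

open Asymptotics

variable {J X : Type*} [Fintype J] [DecidableEq J] [Fintype X] [DecidableEq X]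
  {m dα dg : ℕ} {Ω : Type*} [MeasurableSpace Ω]
  {E : Environment J X m dα dg Ω} {μ : Measure Ω}

lemma Psi_star (h_ident : E.Identification μ) (h_reg : E.Regularity μ) :
    E.Psi E.αstar E.gstar (E.Pstar μ) = E.Pstar μ :=
  (h_ident _ (interior_subset h_reg.interior)).2 rfl

/-- The derivative of `(α, (g, P)) ↦ Ψ(α, g, P)` at the true parameters. -/
def dPsi (E : Environment J X m dα dg Ω) (μ : Measure Ω) :
    EuclideanSpace ℝ (Fin dα) × EuclideanSpace ℝ (Fin dg) × CCP J X m →L[ℝ] CCP J X m :=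
  fderiv ℝ (fun z : EuclideanSpace ℝ (Fin dα) × EuclideanSpace ℝ (Fin dg) × CCP J X m =>
      E.Psi z.1 z.2.1 z.2.2) (E.αstar, E.gstar, E.Pstar μ)

lemma dPsi_apply (h_reg : E.Regularity μ) (a : EuclideanSpace ℝ (Fin dα))
    (g : EuclideanSpace ℝ (Fin dg)) (P : CCP J X m) :
    E.dPsi μ (a, g, P) = Matrix.toEuclideanLin (E.PsiA μ) a + Matrix.toEuclideanLin (E.PsiG μ) g
      + Matrix.toEuclideanLin (E.PsiP μ) P := by
  have hd : HasFDerivAt _ (E.dPsi μ) (E.αstar, E.gstar, E.Pstar μ) :=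
    (h_reg.smooth.differentiableAt (by norm_num)).hasFDerivAt
  have hA : HasFDerivAt (fun α => E.Psi α E.gstar (E.Pstar μ)) _ E.αstar :=
    HasFDerivAt.comp (f := fun α => (α, E.gstar, E.Pstar μ)) E.αstar hd
      (hasFDerivAt_prodMk_left E.αstar (E.gstar, E.Pstar μ))
  have hG : HasFDerivAt (fun g => E.Psi E.αstar g (E.Pstar μ)) _ E.gstar :=
    HasFDerivAt.comp (f := fun g => (E.αstar, g, E.Pstar μ)) E.gstar hd
      ((hasFDerivAt_prodMk_right E.αstar (E.gstar, E.Pstar μ)).comp E.gstar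
        (hasFDerivAt_prodMk_left E.gstar (E.Pstar μ)))
  have hP : HasFDerivAt (fun P => E.Psi E.αstar E.gstar P) _ (E.Pstar μ) :=
    HasFDerivAt.comp (f := fun P => (E.αstar, E.gstar, P)) (E.Pstar μ) hd
      ((hasFDerivAt_prodMk_right E.αstar (E.gstar, E.Pstar μ)).comp (E.Pstar μ)
        (hasFDerivAt_prodMk_right E.gstar (E.Pstar μ)))
  rw [PsiA, PsiG, PsiP, toEuclideanLin_jacobian, toEuclideanLin_jacobian, toEuclideanLin_jacobian,
    hA.fderiv, hG.fderiv, hP.fderiv]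
  simp [← map_add]

/-- The stacked estimator `(P̂, P̂₀, ĝ)`. -/
def stack (E : Environment J X m dα dg Ω) (Pinit : ℕ → Ω → CCP J X m) (n : ℕ) (ω : Ω) :
    EuclideanSpace ℝ (CCPIndex J X m ⊕ (CCPIndex J X m ⊕ Fin dg)) :=
  WithLp.toLp 2 (Sum.elim (E.Phat n ω) (Sum.elim (Pinit n ω) (E.ghat n ω)))

/-- The probability limit of the stacked estimator. -/
def stackStar (E : Environment J X m dα dg Ω) (μ : Measure Ω) :
    EuclideanSpace ℝ (CCPIndex J X m ⊕ (CCPIndex J X m ⊕ Fin dg)) :=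
  WithLp.toLp 2 (Sum.elim (E.Pstar μ) (Sum.elim (E.Pstar μ) E.gstar))

lemma stack_sub (Pinit : ℕ → Ω → CCP J X m) (n : ℕ) (ω : Ω) :
    E.stack Pinit n ω - E.stackStar μ = WithLp.toLp 2 (Sum.elim (E.Phat n ω - E.Pstar μ)
      (WithLp.toLp 2 (Sum.elim (Pinit n ω - E.Pstar μ) (E.ghat n ω - E.gstar) :
        CCPIndex J X m ⊕ Fin dg → ℝ))) := by
  ext i
  rcases i with i | i | i <;> rfl

/-- The sample criteria `Q k n ω`, seen as functions `q k (n, ω)` of the model probabilities, are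
regular, with limiting weights `W k`, in the steps `1, …, K`. -/
structure RegularSteps (E : Environment J X m dα dg Ω) (μ : Measure Ω) (K : ℕ)
    (Q : ℕ → ℕ → Ω → EuclideanSpace ℝ (Fin dα) → EuclideanSpace ℝ (Fin dg) → CCP J X m → ℝ)
    (W : ℕ → Matrix (CCPIndex J X m) (CCPIndex J X m) ℝ)
    (q : ℕ → ℕ × Ω → CCP J X m → ℝ) : Prop where
  eq : ∀ k n ω α g P, Q k n ω α g P = q k (n, ω) (E.Psi α g P)
  posDef : ∀ k ∈ Finset.Icc 1 K, (W k).PosDef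
  regular : ∀ k ∈ Finset.Icc 1 K, RegularCriterion (inProb μ)
    ((fun α => E.Psi α E.gstar (E.Pstar μ)) '' E.Θα) (E.Pstar μ) (fun z => E.Phat z.1 z.2) (q k)
    (Matrix.toEuclideanCLM (𝕜 := ℝ) (W k))

variable {K : ℕ} {Pinit : ℕ → Ω → CCP J X m}
  {Q : ℕ → ℕ → Ω → EuclideanSpace ℝ (Fin dα) → EuclideanSpace ℝ (Fin dg) → CCP J X m → ℝ}
  {W : ℕ → Matrix (CCPIndex J X m) (CCPIndex J X m) ℝ} {q : ℕ → ℕ × Ω → CCP J X m → ℝ}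
  {αhat : ℕ → ℕ → Ω → EuclideanSpace ℝ (Fin dα)}

lemma step_expansion (h_ident : E.Identification μ) (h_reg : E.Regularity μ)
    (hQ : E.RegularSteps μ K Q W q) (hest : E.IsPIEstimator μ K Pinit Q αhat)
    (hX : Tendsto (fun z : ℕ × Ω => E.stack Pinit z.1 z.2) (inProb μ) (𝓝 (E.stackStar μ)))
    {k : ℕ} (hk : k + 1 ∈ Finset.Icc 1 K)
    (hP : (fun z : ℕ × Ω => E.iterCCP Pinit αhat k z.1 z.2 - E.Pstar μ
        - Matrix.toEuclideanLin (phiRow (E.PsiA μ) (E.PsiP μ) (E.PsiG μ) W (k + 1))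
          (E.stack Pinit z.1 z.2 - E.stackStar μ))
      =o[inProb μ] fun z => E.stack Pinit z.1 z.2 - E.stackStar μ) :
    ((fun z : ℕ × Ω => αhat (k + 1) z.1 z.2 - E.αstar
        - Matrix.toEuclideanLin (wlsMap (E.PsiA μ) (W (k + 1))
            * momentRow (E.PsiA μ) (E.PsiP μ) (E.PsiG μ) W (k + 1))
          (E.stack Pinit z.1 z.2 - E.stackStar μ))
      =o[inProb μ] fun z => E.stack Pinit z.1 z.2 - E.stackStar μ) ∧
    ((fun z : ℕ × Ω => E.iterCCP Pinit αhat (k + 1) z.1 z.2 - E.Pstar μ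
        - Matrix.toEuclideanLin (phiRow (E.PsiA μ) (E.PsiP μ) (E.PsiG μ) W (k + 2))
          (E.stack Pinit z.1 z.2 - E.stackStar μ))
      =o[inProb μ] fun z => E.stack Pinit z.1 z.2 - E.stackStar μ) := by
  refine stage_expansion_matrix (Ψ := fun α z => E.Psi α z.1 z.2) (q := q (k + 1))
    (phat := fun z : ℕ × Ω => E.Phat z.1 z.2)
    (ghat := fun z => E.ghat z.1 z.2) (gstar := E.gstar) (pstar := E.Pstar μ)
    (P := fun z => E.iterCCP Pinit αhat k z.1 z.2) (αhat := fun z => αhat (k + 1) z.1 z.2)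
    h_reg.compact h_reg.continuousOn h_reg.uniform h_reg.interior h_ident h_reg.smooth
    (fun a g P => dPsi_apply h_reg a g P) (by rw [h_reg.rank_α, Fintype.card_fin])
    (hQ.posDef _ hk) (hQ.regular _ hk) ?_ ?_ ?_ ?_ hP
  · have : ∀ᶠ z : ℕ × Ω in inProb μ, αhat (k + 1) z.1 z.2 ∈ E.Θα ∧
        IsMaxOn (fun α => Q (k + 1) z.1 z.2 α (E.ghat z.1 z.2)
          (E.iterCCP Pinit αhat k z.1 z.2)) E.Θα (αhat (k + 1) z.1 z.2) := (hest _ hk).2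
    refine this.mono fun z hz => ?_
    simpa only [hQ.eq] using hz
  · simpa using hX.sub_const (E.stackStar μ)
  · intro z
    rw [stack_sub, toEuclideanLin_fromCols, toEuclideanLin_one_apply]
    simp
  · intro z
    rw [stack_sub, gRow, toEuclideanLin_fromCols, toEuclideanLin_fromCols, toEuclideanLin_one_apply]
    simp

/-- Asymptotic linear representation of the `K`-stage estimator. -/
lemma estimator_expansion (h_ident : E.Identification μ) (h_reg : E.Regularity μ) (hK : 1 ≤ K)
    (hQ : E.RegularSteps μ K Q W q) (hest : E.IsPIEstimator μ K Pinit Q αhat)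
    (hX : Tendsto (fun z : ℕ × Ω => E.stack Pinit z.1 z.2) (inProb μ) (𝓝 (E.stackStar μ))) :
    (fun z : ℕ × Ω => αhat K z.1 z.2 - E.αstar
        - Matrix.toEuclideanLin (wlsMap (E.PsiA μ) (W K)
            * momentRow (E.PsiA μ) (E.PsiP μ) (E.PsiG μ) W K)
          (E.stack Pinit z.1 z.2 - E.stackStar μ))
      =o[inProb μ] fun z => E.stack Pinit z.1 z.2 - E.stackStar μ := by
  have hP : ∀ k, k + 1 ≤ K → (fun z : ℕ × Ω => E.iterCCP Pinit αhat k z.1 z.2 - E.Pstar μ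
        - Matrix.toEuclideanLin (phiRow (E.PsiA μ) (E.PsiP μ) (E.PsiG μ) W (k + 1))
          (E.stack Pinit z.1 z.2 - E.stackStar μ))
      =o[inProb μ] fun z => E.stack Pinit z.1 z.2 - E.stackStar μ := by
    intro k
    induction k with
    | zero =>
      intro _
      refine (Asymptotics.isLittleO_zero _ _).congr_left fun z => ?_
      rw [stack_sub, phiRow, toEuclideanLin_fromCols, toEuclideanLin_fromCols]
      simp [phiP, phi0, phiG, iterCCP]
    | succ k ih =>
      intro hk
      exact (step_expansion h_ident h_reg hQ hest hX (Finset.mem_Icc.2 ⟨by omega, by omega⟩)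
        (ih (by omega))).2
  obtain ⟨k, rfl⟩ : ∃ k, K = k + 1 := ⟨K - 1, by omega⟩
  exact (step_expansion h_ident h_reg hQ hest hX (Finset.mem_Icc.2 ⟨by omega, le_rfl⟩)
    (hP k le_rfl)).1

lemma asympNormal_estimator [IsProbabilityMeasure μ] (h_ident : E.Identification μ)
    (h_reg : E.Regularity μ) (hK : 1 ≤ K) (hQ : E.RegularSteps μ K Q W q)
    (hest : E.IsPIEstimator μ K Pinit Q αhat)
    {O : Matrix (CCPIndex J X m ⊕ (CCPIndex J X m ⊕ Fin dg))
      (CCPIndex J X m ⊕ (CCPIndex J X m ⊕ Fin dg)) ℝ} (hO : E.JointNormal μ Pinit O) :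
    AsympNormal μ (αhat K) E.αstar (E.sigmaMD μ O W K) := by
  have h := AsympNormal.of_isLittleO (X := E.stack Pinit) (c := E.stackStar μ) hO
    (wlsMap (E.PsiA μ) (W K) * momentRow (E.PsiA μ) (E.PsiP μ) (E.PsiG μ) W K)
    (hest K (Finset.mem_Icc.2 ⟨hK, le_rfl⟩)).1
    (estimator_expansion h_ident h_reg hK hQ hest (AsympNormal.tendsto_inProb hO))
  rw [Matrix.transpose_mul, ← Matrix.mul_assoc] at h
  exact h

end Environment

/-! ### The minimum-distance criterion -/

section MinimumDistance

variable {ι : Type*} [Fintype ι] [DecidableEq ι]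

lemma continuous_toEuclideanCLM :
    Continuous (fun M : Matrix ι ι ℝ => Matrix.toEuclideanCLM (𝕜 := ℝ) M) :=
  LinearMap.continuous_of_finiteDimensional
    ({ toFun := fun M => Matrix.toEuclideanCLM (𝕜 := ℝ) M
       map_add' := fun M N => map_add _ M N
       map_smul' := fun c M => map_smul _ c M } :
      Matrix ι ι ℝ →ₗ[ℝ] EuclideanSpace ℝ ι →L[ℝ] EuclideanSpace ℝ ι)

/-- The minimum-distance criterion with weight matrix `V`, as a function of the model
probabilities. -/
def distanceCriterion (V : Matrix ι ι ℝ) (phat p : EuclideanSpace ℝ ι) : ℝ :=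
  -(dotProduct (fun i => phat i - p i) (Matrix.mulVec V (fun i => phat i - p i)))

lemma continuous_distanceCriterion :
    Continuous fun z : (Matrix ι ι ℝ × EuclideanSpace ℝ ι) × EuclideanSpace ℝ ι =>
      distanceCriterion z.1.1 z.1.2 z.2 := by
  unfold distanceCriterion
  refine (Continuous.dotProduct ?_ (Continuous.matrix_mulVec ?_ ?_)).neg <;> fun_prop

lemma distanceCriterion_eq_inner (V : Matrix ι ι ℝ) (phat p : EuclideanSpace ℝ ι) :
    distanceCriterion V phat p
      = -inner ℝ (phat - p) (Matrix.toEuclideanCLM (𝕜 := ℝ) V (phat - p)) := by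
  rw [EuclideanSpace.inner_eq_star_dotProduct, dotProduct_comm]
  rfl

lemma eq_of_distanceCriterion_le {V : Matrix ι ι ℝ} (hV : V.PosDef) {phat p : EuclideanSpace ℝ ι}
    (h : distanceCriterion V phat phat ≤ distanceCriterion V phat p) : p = phat := by
  by_contra hne
  have h0 : (fun i => phat i - p i) ≠ 0 := by
    intro h1
    refine hne ?_
    ext i
    exact (sub_eq_zero.1 (congrFun h1 i)).symm
  have h2 := hV.dotProduct_mulVec_pos h0
  simp only [star_trivial] at h2
  have h3 : distanceCriterion V phat phat = 0 := by
    rw [distanceCriterion_eq_inner, sub_self, inner_zero_left, neg_zero]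
  rw [h3, distanceCriterion] at h
  linarith

lemma hasFDerivAt_distanceCriterion {V : Matrix ι ι ℝ} (hV : V.PosSemidef)
    (phat p : EuclideanSpace ℝ ι) : HasFDerivAt (distanceCriterion V phat)
      ((2 : ℝ) • innerSL ℝ (Matrix.toEuclideanCLM (𝕜 := ℝ) V (phat - p))) p := by
  have hM : ∀ u v : EuclideanSpace ℝ ι, inner ℝ (Matrix.toEuclideanCLM (𝕜 := ℝ) V u) v
      = inner ℝ u (Matrix.toEuclideanCLM (𝕜 := ℝ) V v) := by
    intro u v
    have h1 : V.transpose = V := by simpa using hV.isHermitian.eq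
    have h2 := inner_toEuclideanLin V u v
    rwa [h1] at h2
  rw [show distanceCriterion V phat = _ from funext fun p' => distanceCriterion_eq_inner V phat p']
  generalize Matrix.toEuclideanCLM (𝕜 := ℝ) V = M at hM ⊢
  have h1 : HasFDerivAt (fun p' => phat - p') (-ContinuousLinearMap.id ℝ _) p :=
    (hasFDerivAt_id p).const_sub _
  refine (h1.inner ℝ (M.hasFDerivAt.comp p h1)).neg.congr_fderiv ?_
  ext v
  have h2 := hM (phat - p) v
  have h3 : inner ℝ v (M (phat - p)) = inner ℝ (M (phat - p)) v := real_inner_comm _ _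
  simp only [ContinuousLinearMap.comp_neg, ContinuousLinearMap.comp_id, neg_apply,
    ContinuousLinearMap.comp_apply, ContinuousLinearMap.prod_apply, fderivInnerCLM_apply,
    ContinuousLinearMap.id_apply, inner_neg_left, inner_neg_right, smul_apply, innerSL_apply_apply,
    smul_eq_mul, Function.comp_apply]
  linarith

lemma regularCriterion_distance {T : Type*} {l : Filter T} {S : Set (EuclideanSpace ℝ ι)}
    {pstar : EuclideanSpace ℝ ι} {phat : T → EuclideanSpace ℝ ι}
    (hphat : Tendsto phat l (𝓝 pstar)) {What : T → Matrix ι ι ℝ} {W : Matrix ι ι ℝ}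
    (hpsd : ∀ t, (What t).PosSemidef) (hWhat : Tendsto What l (𝓝 W)) (hW : W.PosDef) :
    RegularCriterion l S pstar phat (fun t p => distanceCriterion (What t) (phat t) p)
      (Matrix.toEuclideanCLM (𝕜 := ℝ) W) where
  limit := by
    refine ⟨fun p => distanceCriterion W pstar p, fun p _ => ?_,
      fun p _ h => eq_of_distanceCriterion_le hW h⟩
    have h1 : Tendsto (fun x : T × EuclideanSpace ℝ ι => ((What x.1, phat x.1), x.2)) (l ×ˢ 𝓝 p)
        (𝓝 ((W, pstar), p)) :=
      ((hWhat.comp tendsto_fst).prodMk_nhds (hphat.comp tendsto_fst)).prodMk_nhds tendsto_snd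
    exact (continuous_distanceCriterion (ι := ι)).continuousAt.tendsto.comp h1
  gradient := by
    refine ⟨2, two_ne_zero, fun t _ => Matrix.toEuclideanCLM (𝕜 := ℝ) (What t), ?_,
      .of_forall fun x => hasFDerivAt_distanceCriterion (hpsd x.1) _ _⟩
    exact (continuous_toEuclideanCLM.tendsto W).comp (hWhat.comp tendsto_fst)

end MinimumDistance

namespace Environment

variable {J X : Type*} [Fintype J] [DecidableEq J] [Fintype X] [DecidableEq X]
  {m dα dg : ℕ} {Ω : Type*} [MeasurableSpace Ω]
  {E : Environment J X m dα dg Ω} {μ : Measure Ω}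

lemma regularSteps_MD {K : ℕ}
    {What : ℕ → ℕ → Ω → Matrix (CCPIndex J X m) (CCPIndex J X m) ℝ}
    {W : ℕ → Matrix (CCPIndex J X m) (CCPIndex J X m) ℝ}
    (hphat : Tendsto (fun z : ℕ × Ω => E.Phat z.1 z.2) (inProb μ) (𝓝 (E.Pstar μ)))
    (hW : WeightMatrices μ K What W) :
    E.RegularSteps μ K (E.QMD What) W
      (fun k z p => distanceCriterion (What k z.1 z.2) (E.Phat z.1 z.2) p) where
  eq _ _ _ _ _ _ := rfl
  posDef k hk := (hW k hk).2.2
  regular k hk := by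
    have h1 : Tendsto (fun z : ℕ × Ω => What k z.1 z.2) (inProb μ) (𝓝 (W k)) := by
      refine tendsto_pi_nhds.2 fun i => tendsto_pi_nhds.2 fun i' => ?_
      have h2 := (hW k hk).2.1 i i'
      rwa [tendstoInMeasure_const_iff] at h2
    exact regularCriterion_distance hphat (fun z => (hW k hk).1 z.1 z.2) h1 (hW k hk).2.2

end Environment

/-! ### The pseudo likelihood criterion -/

section Likelihood

variable {J X : Type*} [Fintype J] [DecidableEq J] [Fintype X] [DecidableEq X] {m : ℕ}

/-- The pseudo log-likelihood of model probabilities `p` at sample frequencies `w` of the states and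
`P` of the choices. -/
def pseudoLikelihood (w : X → ℝ) (P p : CCP J X m) : ℝ :=
  ∑ x, w x * ∑ j, ∑ a, P.full j x a * Real.log (p.full j x a)

/-- The weight matrix of the score of the pseudo log-likelihood: block diagonal with blocks
`w(x) (diag(p_{jx})⁻¹ + p_j(0|x)⁻¹ 1 1')`. -/
def scoreWeight (w : X → ℝ) (p : CCP J X m) : Matrix (CCPIndex J X m) (CCPIndex J X m) ℝ :=
  Matrix.of fun i i' => if i.1 = i'.1 ∧ i.2.2 = i'.2.2 then
    w i.2.2 * ((if i.2.1 = i'.2.1 then (p i)⁻¹ else 0) + (p.full i.1 i.2.2 0)⁻¹) else 0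

/-- The asymptotic variance of sample frequencies with choice probabilities `p` and state
probabilities `w`. -/
def frequencyVar (w : X → ℝ) (p : CCP J X m) : Matrix (CCPIndex J X m) (CCPIndex J X m) ℝ :=
  Matrix.of fun i i' => if i.1 = i'.1 ∧ i.2.2 = i'.2.2 then
    ((if i.2.1 = i'.2.1 then p i else 0) - p i * p i') / w i.2.2 else 0

lemma CCP.full_zero (p : CCP J X m) (j : J) (x : X) :
    p.full j x 0 = 1 - ∑ a : Fin m, p (j, a, x) := rfl

lemma CCP.full_succ (p : CCP J X m) (j : J) (x : X) (a : Fin m) :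
    p.full j x a.succ = p (j, a, x) := rfl

lemma CCP.sum_full (p : CCP J X m) (j : J) (x : X) : ∑ a, p.full j x a = 1 := by
  rw [Fin.sum_univ_succ]
  simp [CCP.full_zero, CCP.full_succ]

lemma CCP.continuous_full (j : J) (x : X) (a : Fin (m + 1)) :
    Continuous fun p : CCP J X m => p.full j x a := by
  refine Fin.cases ?_ (fun b => ?_) a
  · simp only [CCP.full_zero]
    fun_prop
  · simp only [CCP.full_succ]
    fun_prop

lemma sum_block (f : CCPIndex J X m → ℝ) (j : J) (x : X) :
    ∑ i : CCPIndex J X m, (if j = i.1 ∧ x = i.2.2 then f i else 0) = ∑ b, f (j, b, x) := by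
  rw [Fintype.sum_prod_type, Finset.sum_eq_single j]
  · rw [Fintype.sum_prod_type]
    refine Finset.sum_congr rfl fun b _ => ?_
    rw [Finset.sum_eq_single x] <;> simp +contextual [eq_comm]
  · intro j' _ hj
    simp [hj.symm]
  · simp

lemma scoreWeight_mulVec (w : X → ℝ) (p : CCP J X m) (u : CCPIndex J X m → ℝ) (j : J) (a : Fin m)
    (x : X) : Matrix.mulVec (scoreWeight w p) u (j, a, x)
      = w x * (u (j, a, x) / p (j, a, x) + (∑ b, u (j, b, x)) / p.full j x 0) := by
  simp only [Matrix.mulVec, dotProduct, scoreWeight, Matrix.of_apply, ite_mul, zero_mul]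
  rw [sum_block (fun i => w x * ((if a = i.2.1 then (p (j, a, x))⁻¹ else 0)
    + (p.full j x 0)⁻¹) * u i)]
  simp only [mul_assoc, ← Finset.mul_sum, add_mul, Finset.sum_add_distrib, ite_mul, zero_mul,
    Finset.sum_ite_eq, Finset.mem_univ, if_true]
  ring

lemma frequencyVar_mulVec (w : X → ℝ) (p : CCP J X m) (u : CCPIndex J X m → ℝ) (j : J) (a : Fin m)
    (x : X) : Matrix.mulVec (frequencyVar w p) u (j, a, x)
      = p (j, a, x) * (u (j, a, x) - ∑ b, p (j, b, x) * u (j, b, x)) / w x := by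
  simp only [Matrix.mulVec, dotProduct, frequencyVar, Matrix.of_apply, ite_mul, zero_mul]
  rw [sum_block (fun i => ((if a = i.2.1 then p (j, a, x) else 0) - p (j, a, x) * p i) / w x * u i)]
  have : ∀ b, ((if a = b then p (j, a, x) else 0) - p (j, a, x) * p (j, b, x)) / w x * u (j, b, x)
      = (if a = b then p (j, a, x) * u (j, b, x) / w x else 0)
        - p (j, a, x) / w x * (p (j, b, x) * u (j, b, x)) := by
    intro b
    split_ifs <;> ring
  simp only [this, Finset.sum_sub_distrib, ← Finset.mul_sum, Finset.sum_ite_eq, Finset.mem_univ,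
    if_true]
  ring

/-- The limit of the score weights is the inverse of the asymptotic variance of the sample
frequencies. -/
lemma scoreWeight_mul_frequencyVar {w : X → ℝ} {p : CCP J X m}
    (hw : ∀ i : CCPIndex J X m, w i.2.2 ≠ 0) (hp : ∀ j x a, p.full j x a ≠ 0) :
    scoreWeight w p * frequencyVar w p = 1 := by
  refine Matrix.ext_of_mulVec_single fun i => ?_
  rw [← Matrix.mulVec_mulVec, Matrix.one_mulVec]
  generalize (Pi.single i 1 : CCPIndex J X m → ℝ) = u
  ext ⟨j, a, x⟩
  have hx := hw (j, a, x)
  have hpa : p (j, a, x) ≠ 0 := by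
    rw [← CCP.full_succ]
    exact hp _ _ _
  have h0 := hp j x 0
  simp only [scoreWeight_mulVec, frequencyVar_mulVec]
  have hsum : ∑ b, p (j, b, x) * (u (j, b, x) - ∑ b, p (j, b, x) * u (j, b, x)) / w x
      = p.full j x 0 * (∑ b, p (j, b, x) * u (j, b, x)) / w x := by
    rw [← Finset.sum_div, CCP.full_zero]
    simp only [mul_sub, Finset.sum_sub_distrib, ← Finset.sum_mul]
    ring
  rw [hsum]
  field_simp
  ring

lemma continuousAt_scoreWeight {w : X → ℝ} {p : CCP J X m} (hp : ∀ j x a, p.full j x a ≠ 0) :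
    ContinuousAt (fun z : (X → ℝ) × CCP J X m => scoreWeight z.1 z.2) (w, p) := by
  refine continuousAt_pi.2 fun i => continuousAt_pi.2 fun i' => ?_
  simp only [scoreWeight, Matrix.of_apply]
  have h1 : ContinuousAt (fun z : (X → ℝ) × CCP J X m => (z.2 i)⁻¹) (w, p) :=
    ContinuousAt.inv₀ (by fun_prop) (hp i.1 i.2.2 i.2.1.succ)
  have h2 : ContinuousAt (fun z : (X → ℝ) × CCP J X m => (z.2.full i.1 i.2.2 0)⁻¹) (w, p) :=
    ContinuousAt.inv₀ ((CCP.continuous_full _ _ _).comp continuous_snd).continuousAt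
      (hp i.1 i.2.2 0)
  split_ifs <;> fun_prop

lemma continuousAt_pseudoLikelihood {w : X → ℝ} {P p : CCP J X m}
    (hp : ∀ j x a, p.full j x a ≠ 0) :
    ContinuousAt (fun z : ((X → ℝ) × CCP J X m) × CCP J X m =>
      pseudoLikelihood z.1.1 z.1.2 z.2) ((w, P), p) := by
  unfold pseudoLikelihood
  refine tendsto_finsetSum _ fun x _ => Tendsto.mul ?_ (tendsto_finsetSum _ fun j _ =>
    tendsto_finsetSum _ fun a _ => Tendsto.mul ?_ (Tendsto.log ?_ (hp j x a)))
  · exact Continuous.tendsto (f := fun z : ((X → ℝ) × CCP J X m) × CCP J X m => z.1.1 x)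
      (by fun_prop) ((w, P), p)
  · exact ((CCP.continuous_full j x a).comp (continuous_snd.comp continuous_fst)).tendsto
      ((w, P), p)
  · exact ((CCP.continuous_full j x a).comp continuous_snd).tendsto ((w, P), p)

lemma hasFDerivAt_pseudoLikelihood (w : X → ℝ) (P : CCP J X m) {p : CCP J X m}
    (hp : ∀ j x a, p.full j x a ≠ 0) :
    HasFDerivAt (pseudoLikelihood w P)
      (innerSL ℝ (Matrix.toEuclideanCLM (𝕜 := ℝ) (scoreWeight w p) (P - p))) p := by
  let ℓ : J → X → Fin (m + 1) → CCP J X m →L[ℝ] ℝ := fun j x =>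
    Fin.cons (-∑ b : Fin m, EuclideanSpace.proj (j, b, x)) (fun b => EuclideanSpace.proj (j, b, x))
  have hℓ : ∀ j x a, HasFDerivAt (fun q : CCP J X m => q.full j x a) (ℓ j x a) p := by
    intro j x a
    refine Fin.cases ?_ (fun b => ?_) a
    · simp only [CCP.full_zero, ℓ, Fin.cons_zero]
      exact (HasFDerivAt.fun_sum fun b _ =>
        (EuclideanSpace.proj (𝕜 := ℝ) ((j, b, x) : CCPIndex J X m)).hasFDerivAt).const_sub 1
    · simp only [CCP.full_succ, ℓ, Fin.cons_succ]
      exact (EuclideanSpace.proj (𝕜 := ℝ) ((j, b, x) : CCPIndex J X m)).hasFDerivAt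
  have hd : HasFDerivAt (pseudoLikelihood w P)
      (∑ x, w x • ∑ j, ∑ a, P.full j x a • (p.full j x a)⁻¹ • ℓ j x a) p :=
    HasFDerivAt.fun_sum fun x _ => (HasFDerivAt.fun_sum fun j _ => HasFDerivAt.fun_sum fun a _ =>
      ((hℓ j x a).log (hp j x a)).const_mul _).const_mul _
  refine hd.congr_fderiv ?_
  ext v
  have hblock : ∀ j x, ∑ a, P.full j x a * ((p.full j x a)⁻¹ * ℓ j x a v)
      = ∑ a : Fin m, (P (j, a, x) / p (j, a, x) - P.full j x 0 / p.full j x 0) * v (j, a, x) := by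
    intro j x
    rw [Fin.sum_univ_succ]
    simp only [ℓ, Fin.cons_zero, Fin.cons_succ, CCP.full_succ, neg_apply, sum_apply,
      PiLp.proj_apply, sub_mul, Finset.sum_sub_distrib, ← Finset.mul_sum]
    have : ∀ a, P (j, a, x) * ((p (j, a, x))⁻¹ * v (j, a, x))
        = P (j, a, x) / p (j, a, x) * v (j, a, x) := fun a => by ring
    simp only [this]
    ring
  have hscore : ∀ j a x, Matrix.toEuclideanCLM (𝕜 := ℝ) (scoreWeight w p) (P - p) (j, a, x)
      = w x * (P (j, a, x) / p (j, a, x) - P.full j x 0 / p.full j x 0) := by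
    intro j a x
    have h1 : p (j, a, x) ≠ 0 := hp j x a.succ
    have h0 := hp j x 0
    have h2 : ∑ b, (P (j, b, x) - p (j, b, x)) = p.full j x 0 - P.full j x 0 := by
      rw [Finset.sum_sub_distrib, CCP.full_zero, CCP.full_zero]
      ring
    refine (scoreWeight_mulVec w p (fun i => P i - p i) j a x).trans ?_
    rw [h2, sub_div, sub_div, div_self h1, div_self h0]
    ring
  simp only [sum_apply, smul_apply, smul_eq_mul, hblock, innerSL_apply_apply, PiLp.inner_apply,
    RCLike.inner_apply, conj_trivial]
  simp only [Fintype.sum_prod_type, hscore]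
  simp only [Finset.mul_sum]
  rw [Finset.sum_comm]
  refine Finset.sum_congr rfl fun j _ => ?_
  rw [Finset.sum_comm]
  refine Finset.sum_congr rfl fun a _ => Finset.sum_congr rfl fun x _ => ?_
  ring

/-- Gibbs' inequality, strict form. -/
lemma eq_of_pseudoLikelihood_le {w : X → ℝ} {P p : CCP J X m} (hw : ∀ x, 0 ≤ w x)
    (hw' : ∀ i : CCPIndex J X m, 0 < w i.2.2) (hP : ∀ j x a, 0 < P.full j x a)
    (hp : ∀ j x a, 0 < p.full j x a) (h : pseudoLikelihood w P P ≤ pseudoLikelihood w P p) :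
    p = P := by
  let δ : X → J → Fin (m + 1) → ℝ := fun x j a => p.full j x a - P.full j x a
    - P.full j x a * Real.log (p.full j x a / P.full j x a)
  have hδ : ∀ x j a, 0 ≤ δ x j a := by
    intro x j a
    have h1 := Real.log_le_sub_one_of_pos (div_pos (hp j x a) (hP j x a))
    have h2 := mul_le_mul_of_nonneg_left h1 (hP j x a).le
    rw [mul_sub, mul_div_cancel₀ _ (hP j x a).ne'] at h2
    simp only [δ]
    linarith
  have hδ' : ∀ x j a, δ x j a = (p.full j x a - P.full j x a)
      - (P.full j x a * Real.log (p.full j x a) - P.full j x a * Real.log (P.full j x a)) := by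
    intro x j a
    simp only [δ]
    rw [Real.log_div (hp j x a).ne' (hP j x a).ne']
    ring
  have hsum : ∑ x, w x * ∑ j, ∑ a, δ x j a = pseudoLikelihood w P P - pseudoLikelihood w P p := by
    simp only [hδ', Finset.sum_sub_distrib, CCP.sum_full, sub_self, zero_sub, neg_sub, mul_sub,
      pseudoLikelihood]
  have hzero := (Finset.sum_eq_zero_iff_of_nonneg fun x _ => mul_nonneg (hw x)
    (Finset.sum_nonneg fun j _ => Finset.sum_nonneg fun a _ => hδ x j a)).1
    (le_antisymm (by rw [hsum]; linarith) (Finset.sum_nonneg fun x _ => mul_nonneg (hw x)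
      (Finset.sum_nonneg fun j _ => Finset.sum_nonneg fun a _ => hδ x j a)))
  ext ⟨j, a, x⟩
  have h1 := (mul_eq_zero.1 (hzero x (Finset.mem_univ _))).resolve_left (hw' (j, a, x)).ne'
  have h2 := (Finset.sum_eq_zero_iff_of_nonneg fun j _ => Finset.sum_nonneg fun a _ =>
    hδ x j a).1 h1 j (Finset.mem_univ _)
  have h3 := (Finset.sum_eq_zero_iff_of_nonneg fun a _ => hδ x j a).1 h2 a.succ (Finset.mem_univ _)
  by_contra hne
  have hne' : p.full j x a.succ / P.full j x a.succ ≠ 1 := by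
    rwa [Ne, div_eq_one_iff_eq (hP j x a.succ).ne']
  have h4 := Real.log_lt_sub_one_of_pos (div_pos (hp j x a.succ) (hP j x a.succ)) hne'
  have h5 := mul_lt_mul_of_pos_left h4 (hP j x a.succ)
  rw [mul_sub, mul_div_cancel₀ _ (hP j x a.succ).ne'] at h5
  simp only [δ] at h3
  linarith

lemma regularCriterion_pseudoLikelihood {T : Type*} {l : Filter T} {S : Set (CCP J X m)}
    {pstar : CCP J X m} {phat : T → CCP J X m} {what : T → X → ℝ} {w : X → ℝ}
    (hphat : Tendsto phat l (𝓝 pstar)) (hwhat : Tendsto what l (𝓝 w)) (hw : ∀ x, 0 ≤ w x)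
    (hw' : ∀ i : CCPIndex J X m, 0 < w i.2.2) (hpstar : ∀ j x a, 0 < pstar.full j x a)
    (hS : ∀ p ∈ S, ∀ j x a, 0 < p.full j x a) :
    RegularCriterion l S pstar phat (fun t p => pseudoLikelihood (what t) (phat t) p)
      (Matrix.toEuclideanCLM (𝕜 := ℝ) (frequencyVar w pstar)⁻¹) where
  limit := by
    refine ⟨fun p => pseudoLikelihood w pstar p, fun p hp => ?_, fun p hp h =>
      eq_of_pseudoLikelihood_le hw hw' hpstar (hS p hp) h⟩
    exact (continuousAt_pseudoLikelihood fun j x a => (hS p hp j x a).ne').tendsto.comp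
        (((hwhat.prodMk_nhds hphat).comp tendsto_fst).prodMk_nhds tendsto_snd)
  gradient := by
    refine ⟨1, one_ne_zero, fun t p => Matrix.toEuclideanCLM (𝕜 := ℝ) (scoreWeight (what t) p),
      ?_, ?_⟩
    · rw [Matrix.inv_eq_left_inv (scoreWeight_mul_frequencyVar (fun i => (hw' i).ne')
        fun j x a => (hpstar j x a).ne')]
      refine (continuous_toEuclideanCLM.tendsto _).comp ?_
      exact (continuousAt_scoreWeight fun j x a => (hpstar j x a).ne').tendsto.comp
        ((hwhat.comp tendsto_fst).prodMk_nhds tendsto_snd)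
    · have hpos : ∀ᶠ p in 𝓝 pstar, ∀ j x a, 0 < CCP.full p j x a :=
        eventually_all.2 fun j => eventually_all.2 fun x => eventually_all.2 fun a =>
          (CCP.continuous_full j x a).continuousAt.eventually (lt_mem_nhds (hpstar j x a))
      filter_upwards [(tendsto_snd (f := l)).eventually hpos] with z hz
      rw [one_smul]
      exact hasFDerivAt_pseudoLikelihood _ _ fun j x a => (hz j x a).ne'

end Likelihood

/-! ### The pseudo likelihood and the sample frequencies -/

namespace Environment

variable {J X : Type*} [Fintype J] [DecidableEq J] [Fintype X] [DecidableEq X]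
  {m dα dg : ℕ} {Ω : Type*} [MeasurableSpace Ω]
  {E : Environment J X m dα dg Ω} {μ : Measure Ω}

/-- Sample frequencies of the states. -/
def stateFreq (E : Environment J X m dα dg Ω) (n : ℕ) (ω : Ω) (x : X) : ℝ :=
  (∑ t ∈ Finset.range n, if (E.data t ω).2.1 = x then (1 : ℝ) else 0) / n

lemma stateFreq_mul_Phat (n : ℕ) (ω : Ω) (j : J) (x : X) (a : Fin m) :
    E.stateFreq n ω x * E.Phat n ω (j, a, x) = (∑ t ∈ Finset.range n,
      if (E.data t ω).1 j = a.succ ∧ (E.data t ω).2.1 = x then (1 : ℝ) else 0) / n := by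
  by_cases h : E.stateFreq n ω x = 0
  · rw [h, zero_mul]
    by_cases hn : n = 0
    · simp [hn]
    · -- a state that does not occur in the sample has no observed choices
      rw [stateFreq, div_eq_zero_iff, or_iff_left (by exact_mod_cast hn),
        Finset.sum_eq_zero_iff_of_nonneg (fun t _ => by split_ifs <;> norm_num)] at h
      rw [Finset.sum_eq_zero, zero_div]
      intro t ht
      have := h t ht
      simp only [ite_eq_right_iff, one_ne_zero, imp_false] at this ⊢
      exact fun h' => this h'.2
  · exact mul_div_cancel₀ _ h

lemma stateFreq_mul_full (n : ℕ) (ω : Ω) (j : J) (x : X) (a : Fin (m + 1)) :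
    E.stateFreq n ω x * (E.Phat n ω).full j x a = (∑ t ∈ Finset.range n,
      if (E.data t ω).1 j = a ∧ (E.data t ω).2.1 = x then (1 : ℝ) else 0) / n := by
  refine Fin.cases ?_ (fun b => stateFreq_mul_Phat n ω j x b) a
  rw [CCP.full_zero, mul_sub, Finset.mul_sum, mul_one]
  simp only [stateFreq_mul_Phat]
  rw [← Finset.sum_div, stateFreq, ← sub_div, Finset.sum_comm, ← Finset.sum_sub_distrib]
  congr 1
  refine Finset.sum_congr rfl fun t _ => ?_
  by_cases hx : (E.data t ω).2.1 = x
  · simp only [hx, if_true, and_true]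
    have h1 := Fin.sum_univ_succ (fun b => if (E.data t ω).1 j = b then (1 : ℝ) else 0)
    rw [Finset.sum_ite_eq, if_pos (Finset.mem_univ _)] at h1
    linarith
  · simp [hx]

/-- The sample frequencies of states and choices are sufficient for the pseudo likelihood. -/
lemma QPML_eq (n : ℕ) (ω : Ω) (α : EuclideanSpace ℝ (Fin dα)) (g : EuclideanSpace ℝ (Fin dg))
    (P : CCP J X m) :
    E.QPML n ω α g P = pseudoLikelihood (E.stateFreq n ω) (E.Phat n ω) (E.Psi α g P) := by
  have h : ∀ (f : J → X → Fin (m + 1) → ℝ) (t : ℕ), ∑ j, f j (E.data t ω).2.1 ((E.data t ω).1 j)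
      = ∑ x, ∑ j, ∑ a, (if (E.data t ω).1 j = a ∧ (E.data t ω).2.1 = x then (1 : ℝ) else 0)
        * f j x a := by
    intro f t
    rw [Finset.sum_comm]
    refine Finset.sum_congr rfl fun j _ => ?_
    rw [Finset.sum_eq_single (E.data t ω).2.1 (fun x _ hx => ?_) (by simp),
      Finset.sum_eq_single ((E.data t ω).1 j) (fun a _ ha => ?_) (by simp)]
    · simp
    · simp [ha.symm]
    · simp [hx.symm]
  rw [QPML, pseudoLikelihood]
  simp only [h (fun j x a => Real.log ((E.Psi α g P).full j x a)), Finset.mul_sum, ← mul_assoc,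
    stateFreq_mul_full]
  rw [Finset.sum_comm, Finset.sum_div]
  refine Finset.sum_congr rfl fun x _ => ?_
  rw [Finset.sum_comm, Finset.sum_div]
  refine Finset.sum_congr rfl fun j _ => ?_
  rw [Finset.sum_comm, Finset.sum_div]
  refine Finset.sum_congr rfl fun a _ => ?_
  rw [← Finset.sum_mul, div_mul_eq_mul_div]

lemma mstar_nonneg (x : X) : 0 ≤ E.mstar μ x :=
  Finset.sum_nonneg fun _ _ => Finset.sum_nonneg fun _ _ => measureReal_nonneg

/-- The law of large numbers for the state frequencies. -/
lemma tendsto_stateFreq [MeasurableSpace X] [DiscreteMeasurableSpace X] [IsProbabilityMeasure μ]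
    (h_iid : E.IIDFromMPE μ) :
    Tendsto (fun z : ℕ × Ω => E.stateFreq z.1 z.2) (inProb μ) (𝓝 (E.mstar μ)) := by
  refine tendsto_pi_nhds.2 fun x => ?_
  let φ : Obs J X m → ℝ := fun o => if o.2.1 = x then 1 else 0
  have hφ : Measurable φ :=
    (Measurable.of_discrete (f := fun x' : X => if x' = x then (1 : ℝ) else 0)).comp
      (measurable_fst.comp measurable_snd)
  have hmeas : ∀ t, Measurable (φ ∘ E.data t) := fun t => hφ.comp (h_iid.measurable t)
  have hint : Integrable (φ ∘ E.data 0) μ := by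
    refine Integrable.of_bound (hmeas 0).aestronglyMeasurable 1 (.of_forall fun ω => ?_)
    simp only [φ, Function.comp_apply]
    split_ifs <;> simp
  have hmean : ∫ ω, (φ ∘ E.data 0) ω ∂μ = E.mstar μ x := by
    have hset : ∀ b x', MeasurableSet {ω | E.data 0 ω = (b, x, x')} := fun b x' =>
      h_iid.measurable 0 (measurableSet_singleton (b, x, x'))
    have h1 : ∀ ω, (φ ∘ E.data 0) ω = ∑ b : J → Fin (m + 1), ∑ x',
        {ω | E.data 0 ω = (b, x, x')}.indicator (1 : Ω → ℝ) ω := by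
      intro ω
      rcases hd : E.data 0 ω with ⟨b₀, x₀, x₀'⟩
      simp only [Function.comp_apply, φ, Set.indicator_apply, Set.mem_ofPred_eq, hd, Prod.mk.injEq,
        Pi.one_apply]
      rw [Finset.sum_eq_single b₀ (fun b _ hb => ?_) (by simp),
        Finset.sum_eq_single x₀' (fun x' _ hx' => ?_) (by simp)]
      · simp
      · simp [hx'.symm]
      · simp [hb.symm]
    simp only [h1]
    rw [integral_finsetSum _ fun b _ => integrable_finsetSum _ fun x' _ =>
      (integrable_indicator_iff (hset b x')).2 (integrable_const _).integrableOn]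
    refine Finset.sum_congr rfl fun b _ => ?_
    rw [integral_finsetSum _ fun x' _ =>
      (integrable_indicator_iff (hset b x')).2 (integrable_const _).integrableOn]
    exact Finset.sum_congr rfl fun x' _ => integral_indicator_one (hset b x')
  have hlaw := strong_law_ae_real (fun t => φ ∘ E.data t) hint
    (fun s t hst => (h_iid.indep.indepFun hst).comp hφ hφ)
    (fun t => (h_iid.ident t).comp hφ)
  rw [hmean] at hlaw
  refine tendstoInMeasure_const_iff (f := fun n ω => E.stateFreq n ω x).1 ?_
  refine tendstoInMeasure_of_tendsto_ae (fun n => ?_) hlaw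
  exact ((Finset.measurable_sum _ fun t _ => hmeas t).div_const _).aestronglyMeasurable

lemma OPP_eq : E.OPP μ = frequencyVar (E.mstar μ) (E.Pstar μ) := rfl

/-- At a state of probability zero the block of `Ω_PP` would vanish, by `x / 0 = 0`. -/
lemma mstar_pos (h : (E.OPP μ).PosDef) (i : CCPIndex J X m) : 0 < E.mstar μ i.2.2 := by
  refine (mstar_nonneg _).lt_of_ne fun h0 => ?_
  have h1 := h.diag_pos (i := i)
  simp [OPP, ← h0] at h1

lemma regularSteps_PML [MeasurableSpace X] [DiscreteMeasurableSpace X] [IsProbabilityMeasure μ]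
    (h_iid : E.IIDFromMPE μ) (h_ident : E.Identification μ) (h_reg : E.Regularity μ)
    (hOPP : (E.OPP μ).PosDef)
    (hphat : Tendsto (fun z : ℕ × Ω => E.Phat z.1 z.2) (inProb μ) (𝓝 (E.Pstar μ))) (K : ℕ) :
    E.RegularSteps μ K (fun _ => E.QPML) (fun _ => (E.OPP μ)⁻¹)
      (fun _ z p => pseudoLikelihood (E.stateFreq z.1 z.2) (E.Phat z.1 z.2) p) where
  eq _ n ω α g P := QPML_eq n ω α g P
  posDef _ _ := hOPP.inv
  regular _ _ := by
    have hpos : ∀ α ∈ E.Θα, ∀ j x a, 0 < (E.Psi α E.gstar (E.Pstar μ)).full j x a := by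
      intro α hα j x a
      obtain ⟨c, hc, h⟩ := (h_reg.positive j x a).self_of_nhds
      exact hc.trans_le (h α hα)
    have hstar := hpos _ (interior_subset h_reg.interior)
    rw [Psi_star h_ident h_reg] at hstar
    rw [OPP_eq]
    refine regularCriterion_pseudoLikelihood hphat (tendsto_stateFreq h_iid) mstar_nonneg
      (mstar_pos hOPP) hstar ?_
    rintro p ⟨α, hα, rfl⟩
    exact hpos α hα

end Environment

/-! ### Invariance and optimality -/

lemma eq_of_posSemidef_sub {κ : Type*} [Fintype κ] {M N : Matrix κ κ ℝ}
    (h : (M - N).PosSemidef) (h' : (N - M).PosSemidef) : M = N := by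
  open scoped MatrixOrder in
  exact le_antisymm (Matrix.le_iff.2 h') (Matrix.le_iff.2 h)

namespace Environment

variable {J X : Type*} [Fintype J] [DecidableEq J] [Fintype X] [DecidableEq X]
  {m dα dg : ℕ} {Ω : Type*} [MeasurableSpace Ω]
  {E : Environment J X m dα dg Ω} {μ : Measure Ω}
  {W : ℕ → Matrix (CCPIndex J X m) (CCPIndex J X m) ℝ} {K : ℕ}

lemma rank_PsiA (h_reg : E.Regularity μ) : (E.PsiA μ).rank = Fintype.card (Fin dα) := by
  rw [h_reg.rank_α, Fintype.card_fin]

lemma posDef_O2 [IsProbabilityMeasure μ] (h_base : E.Baseline μ) (h_base2 : E.BaselineII μ) :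
    (E.O2 μ).PosDef := by
  have h := h_base.1.submatrix (Sum.map id Sum.inr)
  have h1 : (E.O3 μ).submatrix (Sum.map id Sum.inr) (Sum.map id Sum.inr) = E.O2 μ := by
    ext (i | i) (j | j) <;> rfl
  rw [h1] at h
  exact h.posDef_iff_det_ne_zero.2 h_base2.nonsingular.ne_zero

lemma posDef_OPP [IsProbabilityMeasure μ] (h_base : E.Baseline μ) (h_base2 : E.BaselineII μ) :
    (E.OPP μ).PosDef :=
  (posDef_O2 h_base h_base2).submatrix Sum.inl_injective

lemma posDef_optWeightInv [IsProbabilityMeasure μ] (h_reg : E.Regularity μ)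
    (h_base : E.Baseline μ) (h_base2 : E.BaselineII μ) :
    (optWeightInv (E.PsiP μ) (E.PsiG μ) (E.OPP μ) E.OPg E.Ogg).PosDef := by
  rw [optWeightInv_eq]
  have h := posDef_transpose_mul_mul
    (A := (Matrix.fromCols (1 - E.PsiP μ) (-E.PsiG μ)).transpose)
    (by rw [Matrix.rank_transpose, h_reg.rank_fixedPoint]) (posDef_O2 h_base h_base2)
  rwa [Matrix.transpose_transpose] at h

lemma transpose_OPP (h : (E.OPP μ).PosDef) : (E.OPP μ).transpose = E.OPP μ := by
  simpa using h.isHermitian.eq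

lemma Delta_eq (hK : 1 ≤ K) : E.Delta μ W K = errorFactor (E.PsiA μ) (E.PsiP μ) W K
    * optWeightInv (E.PsiP μ) (E.PsiG μ) (E.OPP μ) E.OPg E.Ogg
    * (errorFactor (E.PsiA μ) (E.PsiP μ) W K).transpose := by
  obtain ⟨k, rfl⟩ : ∃ k, K = k + 1 := ⟨K - 1, by omega⟩
  exact deltaFormula_eq _ _ _ _ _

lemma errorFactor_mul_PsiA (h_reg : E.Regularity μ) (hK : 1 ≤ K)
    (hW : ∀ k ∈ Finset.Icc 1 (K - 1), (W k).PosDef) :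
    errorFactor (E.PsiA μ) (E.PsiP μ) W K * E.PsiA μ = E.PsiA μ := by
  obtain ⟨k, rfl⟩ : ∃ k, K = k + 1 := ⟨K - 1, by omega⟩
  exact errorFactor_mul (rank_PsiA h_reg) k hW

lemma Delta_update (V : Matrix (CCPIndex J X m) (CCPIndex J X m) ℝ) :
    E.Delta μ (Function.update W K V) K = E.Delta μ W K := by
  obtain ⟨h1, h2, h3⟩ := phi_congr (A := E.PsiA μ) (D := E.PsiP μ) (W := Function.update W K V)
    (W' := W) K fun i hi => Function.update_of_ne hi.ne _ _
  rw [Delta, Delta, deltaFormula, deltaFormula, h1, h2, h3]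

lemma sigmaMD_O3equiv (hOPP : (E.OPP μ).PosDef) : E.sigmaMD μ (E.O3equiv μ) W K
    = wlsMap (E.PsiA μ) (W K) * E.Delta μ W K * (wlsMap (E.PsiA μ) (W K)).transpose :=
  sigmaMDFormula_equiv _ _ _ (transpose_OPP hOPP) _ _

lemma sigmaMD_O3equiv_update (hOPP : (E.OPP μ).PosDef)
    (V : Matrix (CCPIndex J X m) (CCPIndex J X m) ℝ) :
    E.sigmaMD μ (E.O3equiv μ) (Function.update W K V) K
      = wlsMap (E.PsiA μ) V * E.Delta μ W K * (wlsMap (E.PsiA μ) V).transpose := by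
  rw [sigmaMD_O3equiv hOPP, Delta_update, Function.update_self]

lemma posDef_Delta [IsProbabilityMeasure μ] (h_reg : E.Regularity μ)
    (h_base : E.Baseline μ) (h_base2 : E.BaselineII μ) (hK : 1 ≤ K)
    (hΔ : IsUnit (E.Delta μ W K).det) : (E.Delta μ W K).PosDef := by
  have h := (posDef_optWeightInv h_reg h_base h_base2).posSemidef.mul_mul_conjTranspose_same
    (errorFactor (E.PsiA μ) (E.PsiP μ) W K)
  rw [Matrix.conjTranspose_eq_transpose_of_trivial, ← Delta_eq hK] at h
  exact h.posDef_iff_det_ne_zero.2 hΔ.ne_zero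

lemma isOptimalLast_update [IsProbabilityMeasure μ] (h_reg : E.Regularity μ)
    (h_base : E.Baseline μ) (h_base2 : E.BaselineII μ) (hK : 1 ≤ K)
    (hΔ : IsUnit (E.Delta μ W K).det) :
    E.IsOptimalLast μ (Function.update W K (E.Delta μ W K)⁻¹) K := by
  have hOPP := posDef_OPP h_base h_base2
  have hpd := posDef_Delta h_reg h_base h_base2 hK hΔ
  refine ⟨by simpa using hpd.inv, fun V hV => ?_⟩
  rw [Function.update_idem, sigmaMD_O3equiv_update hOPP, sigmaMD_O3equiv_update hOPP,
    wlsMap_inv_variance (rank_PsiA h_reg) hpd]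
  exact gaussMarkov (rank_PsiA h_reg) hpd (wlsMap_mul (rank_PsiA h_reg) hV)

/-- Any optimal weight in the last step attains `Σ*`. -/
lemma sigmaMD_of_isOptimalLast [IsProbabilityMeasure μ] (h_reg : E.Regularity μ)
    (h_base : E.Baseline μ) (h_base2 : E.BaselineII μ) (hK : 1 ≤ K)
    (hW : ∀ k ∈ Finset.Icc 1 (K - 1), (W k).PosDef)
    (hΔ : IsUnit (E.Delta μ W K).det) (hopt : E.IsOptimalLast μ W K) :
    E.sigmaMD μ (E.O3equiv μ) W K = E.sigmaStar μ := by
  have hOPP := posDef_OPP h_base h_base2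
  have hpd := posDef_Delta h_reg h_base h_base2 hK hΔ
  have hB : IsUnit (errorFactor (E.PsiA μ) (E.PsiP μ) W K).det := by
    rw [Delta_eq hK, Matrix.det_mul, Matrix.det_mul] at hΔ
    exact isUnit_of_mul_isUnit_left (isUnit_of_mul_isUnit_left hΔ)
  -- the optimal weight does at least as well as `Δ_K⁻¹`, which attains the Gauss–Markov bound
  have h1 := hopt.2 _ hpd.inv
  rw [sigmaMD_O3equiv_update hOPP, wlsMap_inv_variance (rank_PsiA h_reg) hpd] at h1
  have h2 := gaussMarkov (rank_PsiA h_reg) hpd (wlsMap_mul (rank_PsiA h_reg) hopt.1)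
  rw [← sigmaMD_O3equiv hOPP] at h2
  rw [eq_of_posSemidef_sub h2 h1, Delta_eq hK,
    optimal_variance_eq hB (errorFactor_mul_PsiA h_reg hK hW)]
  rfl

/-- No weights and no initial CCP estimator improve on `Σ*`. -/
lemma sigmaMD_sub_sigmaStar [IsProbabilityMeasure μ] (h_reg : E.Regularity μ)
    (h_base : E.Baseline μ) (h_base2 : E.BaselineII μ) (hK : 1 ≤ K)
    (hW : ∀ k ∈ Finset.Icc 1 K, (W k).PosDef) :
    (E.sigmaMD μ (E.O3 μ) W K - E.sigmaStar μ).PosSemidef := by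
  have hOPP := posDef_OPP h_base h_base2
  obtain ⟨h1, h2, h3⟩ := uncorrelated_of_efficient (transpose_OPP hOPP) h_base2.efficient
  have hrank := rank_PsiA h_reg
  rw [sigmaMD, O3, h1, h2, sigmaMDFormula_uncorrelated _ _ _ _ (transpose_OPP hOPP),
    add_sub_right_comm]
  have h4 := h3.mul_mul_conjTranspose_same
    (wlsMap (E.PsiA μ) (W K) * (E.PsiP μ * phi0 (E.PsiA μ) (E.PsiP μ) W K))
  rw [Matrix.conjTranspose_eq_transpose_of_trivial] at h4
  refine Matrix.PosSemidef.add ?_ h4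
  have hN : wlsMap (E.PsiA μ) (W K) * errorFactor (E.PsiA μ) (E.PsiP μ) W K * E.PsiA μ = 1 := by
    rw [Matrix.mul_assoc, errorFactor_mul_PsiA h_reg hK fun k hk =>
      hW k (Finset.Icc_subset_Icc_right (by omega) hk)]
    exact wlsMap_mul hrank (hW K (Finset.mem_Icc.2 ⟨hK, le_rfl⟩))
  have h6 := gaussMarkov hrank (posDef_optWeightInv h_reg h_base h_base2) hN
  have h5 := Delta_eq (E := E) (μ := μ) (W := W) hK
  rw [Delta] at h5
  rw [h5, sigmaStar]
  rw [Matrix.transpose_mul] at h6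
  simp only [Matrix.mul_assoc] at h6 ⊢
  exact h6

/-- The joint limit law when the initial CCP estimator is asymptotically equivalent to the sample
frequencies. -/
lemma jointNormal_of_asympEquiv [IsProbabilityMeasure μ] (h_base : E.Baseline μ)
    (hOPP : (E.OPP μ).PosDef) {Ptilde : ℕ → Ω → CCP J X m}
    (hmeas : ∀ n, AEMeasurable (Ptilde n) μ) (hequiv : E.AsympEquiv μ Ptilde) :
    E.JointNormal μ Ptilde (E.O3equiv μ) := by
  -- the matrix of `(u, v, w) ↦ (u, u, w)`
  let e : CCPIndex J X m ⊕ (CCPIndex J X m ⊕ Fin dg) →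
      CCPIndex J X m ⊕ (CCPIndex J X m ⊕ Fin dg) :=
    Sum.elim Sum.inl (Sum.elim Sum.inl fun g => Sum.inr (Sum.inr g))
  let L : Matrix (CCPIndex J X m ⊕ (CCPIndex J X m ⊕ Fin dg))
    (CCPIndex J X m ⊕ (CCPIndex J X m ⊕ Fin dg)) ℝ := (1 : Matrix _ _ ℝ).submatrix e id
  have hL : L * E.O3 μ * L.transpose = E.O3equiv μ := by
    have h1 : L * E.O3 μ * L.transpose = (E.O3 μ).submatrix e e := by
      ext i j
      simp [L, Matrix.mul_apply, Matrix.one_apply]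
    rw [h1]
    have h2 : ∀ i j, E.OPP μ i j = E.OPP μ j i := fun i j =>
      congrFun (congrFun (transpose_OPP hOPP) j) i
    ext (i | i | i) (j | j | j) <;> first | rfl | exact h2 _ _
  have hLapp : ∀ v i, Matrix.toEuclideanLin L v i = v (e i) := by
    intro v i
    simp [L, Matrix.toLpLin_apply, Matrix.mulVec, dotProduct, Matrix.one_apply]
  have hcoord : ∀ (n : ℕ) i, AEMeasurable
      (fun ω => (√(n : ℝ) • (E.stack E.P0hat n ω - E.stackStar μ)) i) μ := fun n i =>
    (EuclideanSpace.proj (𝕜 := ℝ) i).continuous.measurable.comp_aemeasurable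
      (h_base.2.forall_aemeasurable n)
  rw [JointNormal, ← hL]
  refine AsympNormal.of_linear (X := E.stack E.P0hat) (c := E.stackStar μ) h_base L ?_ ?_
  · intro n
    refine (WithLp.measurable_toLp 2 _).comp_aemeasurable (aemeasurable_pi_lambda _ fun i => ?_)
    rcases i with i | i | i
    · exact hcoord n (Sum.inl i)
    · exact (((EuclideanSpace.proj (𝕜 := ℝ) i).continuous.measurable.comp_aemeasurable
        (hmeas n)).sub_const _).const_mul _
    · exact hcoord n (Sum.inr (Sum.inr i))
  · have hc : Continuous fun d : CCP J X m =>
        (WithLp.toLp 2 (Sum.elim 0 (Sum.elim d 0)) :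
          EuclideanSpace ℝ (CCPIndex J X m ⊕ (CCPIndex J X m ⊕ Fin dg))) := by
      refine (PiLp.continuous_toLp 2 _).comp (continuous_pi fun i => ?_)
      rcases i with i | i | i
      · exact continuous_const
      · exact (EuclideanSpace.proj (𝕜 := ℝ) i).continuous
      · exact continuous_const
    have h := (hc.tendsto 0).comp (tendstoInMeasure_const_iff.1 hequiv)
    convert h using 1
    · ext z i
      rw [PiLp.sub_apply, hLapp]
      rcases i with i | i | i
      · exact sub_self _
      · rfl
      · exact sub_self _
    · congr 1
      ext i
      rcases i with i | i | i <;> rfl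

lemma tendsto_Phat [IsProbabilityMeasure μ] (h_base : E.Baseline μ) :
    Tendsto (fun z : ℕ × Ω => E.Phat z.1 z.2) (inProb μ) (𝓝 (E.Pstar μ)) := by
  have h := AsympNormal.tendsto_inProb h_base
  have hc : Continuous fun v : EuclideanSpace ℝ (CCPIndex J X m ⊕ (CCPIndex J X m ⊕ Fin dg)) =>
      (WithLp.toLp 2 fun i => v (Sum.inl i) : CCP J X m) := by
    fun_prop
  exact (hc.tendsto _).comp h

lemma asympNormal_KMD [IsProbabilityMeasure μ] (h_ident : E.Identification μ)
    (h_reg : E.Regularity μ) (h_base : E.Baseline μ) (hK : 1 ≤ K) {Pinit : ℕ → Ω → CCP J X m}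
    {What : ℕ → ℕ → Ω → Matrix (CCPIndex J X m) (CCPIndex J X m) ℝ}
    {αhat : ℕ → ℕ → Ω → EuclideanSpace ℝ (Fin dα)}
    {O : Matrix (CCPIndex J X m ⊕ (CCPIndex J X m ⊕ Fin dg))
      (CCPIndex J X m ⊕ (CCPIndex J X m ⊕ Fin dg)) ℝ}
    (hO : E.JointNormal μ Pinit O) (hW : WeightMatrices μ K What W)
    (hest : E.IsKMD μ K Pinit What αhat) :
    AsympNormal μ (αhat K) E.αstar (E.sigmaMD μ O W K) :=
  asympNormal_estimator h_ident h_reg hK (regularSteps_MD (tendsto_Phat h_base) hW) hest hO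

lemma Delta_one : E.Delta μ W 1 = optWeightInv (E.PsiP μ) (E.PsiG μ) (E.OPP μ) E.OPg E.Ogg := by
  rw [Delta_eq le_rfl, errorFactor_one, Matrix.one_mul, Matrix.transpose_one, Matrix.mul_one]

end Environment

end

theorem theorem4 {J X : Type*} [Fintype J] [DecidableEq J] [Fintype X] [DecidableEq X]
    [MeasurableSpace X] [DiscreteMeasurableSpace X] {m dα dg : ℕ}
    {Ω : Type*} [MeasurableSpace Ω] (μ : Measure Ω) [IsProbabilityMeasure μ]
    (E : Environment J X m dα dg Ω)
    (h_iid : E.IIDFromMPE μ)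
    (h_ident : E.Identification μ)
    (h_reg : E.Regularity μ)
    (h_base : E.Baseline μ)
    (h_base2 : E.BaselineII μ)
    (K : ℕ) (hK : 1 ≤ K) :
    -- Invariance
    (∀ W : ℕ → Matrix (CCPIndex J X m) (CCPIndex J X m) ℝ,
      (∀ k ∈ Finset.Icc 1 (K - 1), (W k).PosDef) → IsUnit (E.Delta μ W K).det →
        E.IsOptimalLast μ (Function.update W K (E.Delta μ W K)⁻¹) K ∧
        ∀ (Ptilde : ℕ → Ω → CCP J X m), (∀ n, AEMeasurable (Ptilde n) μ) →
          E.AsympEquiv μ Ptilde →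
            E.JointNormal μ Ptilde (E.O3equiv μ) ∧
            ∀ (What : ℕ → ℕ → Ω → Matrix (CCPIndex J X m) (CCPIndex J X m) ℝ)
              (αhat : ℕ → ℕ → Ω → EuclideanSpace ℝ (Fin dα)),
              E.IsOptimalLast μ W K → WeightMatrices μ K What W →
                E.IsKMD μ K Ptilde What αhat →
                  AsympNormal μ (αhat K) E.αstar (E.sigmaStar μ)) ∧
    -- Optimality
    (∀ (What : ℕ → ℕ → Ω → Matrix (CCPIndex J X m) (CCPIndex J X m) ℝ)
        (W : ℕ → Matrix (CCPIndex J X m) (CCPIndex J X m) ℝ)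
        (αhat : ℕ → ℕ → Ω → EuclideanSpace ℝ (Fin dα)),
        WeightMatrices μ K What W → E.IsKMD μ K E.P0hat What αhat →
          AsympNormal μ (αhat K) E.αstar (E.sigmaMD μ (E.O3 μ) W K) ∧
          (E.sigmaMD μ (E.O3 μ) W K - E.sigmaStar μ).PosSemidef) ∧
    -- The optimal `1`-MD estimator is well defined and has asymptotic variance `Σ*`
    ((E.W1star μ).PosDef ∧ E.IsOptimalLast μ (fun _ => E.W1star μ) 1 ∧
      (E.sigmaStar μ).PosDef ∧ E.sigmaMD μ (E.O3equiv μ) (fun _ => E.W1star μ) 1 = E.sigmaStar μ ∧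
      ∀ (Ptilde : ℕ → Ω → CCP J X m), (∀ n, AEMeasurable (Ptilde n) μ) → E.AsympEquiv μ Ptilde →
        ∀ (What : ℕ → ℕ → Ω → Matrix (CCPIndex J X m) (CCPIndex J X m) ℝ)
          (αhat : ℕ → ℕ → Ω → EuclideanSpace ℝ (Fin dα)),
          WeightMatrices μ 1 What (fun _ => E.W1star μ) → E.IsKMD μ 1 Ptilde What αhat →
            AsympNormal μ (αhat 1) E.αstar (E.sigmaStar μ)) ∧
    -- Comparison with the `K`-PML estimator
    (∀ (αhat : ℕ → ℕ → Ω → EuclideanSpace ℝ (Fin dα)), E.IsKPML μ K E.P0hat αhat →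
        AsympNormal μ (αhat K) E.αstar (E.sigmaPML μ K) ∧
        (E.sigmaPML μ K - E.sigmaStar μ).PosSemidef) := by
  have hOPP := Environment.posDef_OPP h_base h_base2
  have hpd := Environment.posDef_optWeightInv h_reg h_base h_base2
  have hW1 : (fun _ => E.W1star μ : ℕ → Matrix (CCPIndex J X m) (CCPIndex J X m) ℝ)
      = Function.update (fun _ => E.W1star μ) 1 (E.Delta μ (fun _ => E.W1star μ) 1)⁻¹ := by
    rw [Environment.Delta_one]
    exact (Function.update_eq_self 1 _).symm
  have hΔ1 : IsUnit (E.Delta μ (fun _ => E.W1star μ) 1).det := by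
    rw [Environment.Delta_one]
    exact hpd.det_pos.ne'.isUnit
  have hopt1 : E.IsOptimalLast μ (fun _ => E.W1star μ) 1 := by
    rw [hW1]
    exact Environment.isOptimalLast_update h_reg h_base h_base2 le_rfl hΔ1
  have hσ1 : E.sigmaMD μ (E.O3equiv μ) (fun _ => E.W1star μ) 1 = E.sigmaStar μ :=
    Environment.sigmaMD_of_isOptimalLast h_reg h_base h_base2 le_rfl (by simp) hΔ1 hopt1
  refine ⟨fun W hW hΔ => ⟨Environment.isOptimalLast_update h_reg h_base h_base2 hK hΔ,
    fun Ptilde hmeas hequiv => ?_⟩, fun What W αhat hW hest => ⟨?_, ?_⟩,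
    ⟨hpd.inv, hopt1, ?_, hσ1, fun Ptilde hmeas hequiv What αhat hW hest => ?_⟩,
    fun αhat hest => ⟨?_, ?_⟩⟩
  · have hjoint := Environment.jointNormal_of_asympEquiv h_base hOPP hmeas hequiv
    refine ⟨hjoint, fun What αhat hopt hWhat hest => ?_⟩
    rw [← Environment.sigmaMD_of_isOptimalLast h_reg h_base h_base2 hK hW hΔ hopt]
    exact Environment.asympNormal_KMD h_ident h_reg h_base hK hjoint hWhat hest
  · exact Environment.asympNormal_KMD h_ident h_reg h_base hK h_base hW hest
  · exact Environment.sigmaMD_sub_sigmaStar h_reg h_base h_base2 hK fun k hk => (hW k hk).2.2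
  · exact (posDef_transpose_mul_mul (Environment.rank_PsiA h_reg) hpd.inv).inv
  · rw [← hσ1]
    exact Environment.asympNormal_KMD h_ident h_reg h_base le_rfl
      (Environment.jointNormal_of_asympEquiv h_base hOPP hmeas hequiv) hW hest
  · exact Environment.asympNormal_estimator h_ident h_reg hK
      (Environment.regularSteps_PML h_iid h_ident h_reg hOPP (Environment.tendsto_Phat h_base) K)
      hest h_base
  · exact Environment.sigmaMD_sub_sigmaStar h_reg h_base h_base2 hK fun _ _ => hOPP.inv
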